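/- Let $\nu,\eta\in\mathbb R$ and consider, for $U=(u_1,u_2,u_3,u_4)^{T}\in\mathbb R^4$, the radial stationary Swift–Hohenberg system on the hyperbolic plane $$U_\tau=\mathcal A(\tau)U+\mathcal F(U,\lambda),\qquad \mathcal A(\tau)=\begin{pmatrix}0&0&1&0\\0&0&0&1\\-1&1&-\coth\tau&0\\0&-1&0&-\coth\tau\end{pmatrix},\quad \mathcal F(U,\lambda)=\begin{pmatrix}0\\0\\0\\ \lambda u_1+\nu u_1^2-\eta u_1^3\end{pmatrix}.\tag{1}$$ Let $\alpha_0=-\tfrac12+i\tfrac{\sqrt3}{2}$, and write $$P(\tau)=\mathcal P_{\alpha_0}(\cosh\tau),\quad P^1(\tau)=\mathcal P^1_{\alpha_0}(\cosh\tau),\quad Q(\tau)=\mathcal Q_{\alpha_0}(\cosh\tau),\quad Q^1(\tau)=\mathcal Q^1_{\alpha_0}(\cosh\tau).$$ Here $\mathcal P_{\alpha_0}(z)=\frac1\pi\int_0^\pi (z+\sqrt{z^2-1}\cos\theta)^{\alpha_0}d\theta$ is the (real-valued) Legendre function of the first kind, $\mathcal Q_{\alpha_0}(z)=\operatorname{Re}\int_0^\infty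 (z+\sqrt{z^2-1}\cosh t)^{-\alpha_0-1}dt$ is the real part of the Legendre function of the second kind, and $\mathcal P^1_{\alpha_0}(z)=\sqrt{z^2-1}\,\mathcal P_{\alpha_0}'(z)$, $\mathcal Q^1_{\alpha_0}(z)=\sqrt{z^2-1}\,\mathcal Q_{\alpha_0}'(z)$. With $$I_{PP}(\tau)=\int_0^\tau P^2\sinh s\,ds,\quad I_{PQ}(\tau)=\int_0^\tau PQ\sinh s\,ds,\quad I_{QQ}(\tau)=\int_0^\tau Q^2\sinh s\,ds,$$ put $$V_1=(P,0,P^1,0)^T,\quad V_2=(P I_{PQ}-Q I_{PP},\;P,\;P^1 I_{PQ}-Q^1 I_{PP},\;P^1)^T,$$ $$V_3=(Q,0,Q^1,0)^T,\quad V_4=(P I_{QQ}-Q I_{PQ},\;Q,\;P^1 I_{QQ}-Q^1 I_{PQ},\;Q^1)^T .$$ Then the integral $\mathcal I=\int_0^\infty P(s)^3\sinh s\,ds$ converges absolutely, and there are functions $\rho(\tau_0)\to0$ and $\varepsilon(\tau_0)\to0$ as $\tau_0\to\infty$ such that the following holds for every $\tau_0>0$. The vectors $V_1(\tau_0),\dots,V_4(\tau_0)$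 are linearly independent; let $P_-^{cu}(\tau_0)$ be the projection onto $\mathrm{span}\{V_1(\tau_0),V_2(\tau_0)\}$ with null space $\mathrm{span}\{V_3(\tau_0),V_4(\tau_0)\}$. There exist $\delta_0,\delta_1>0$, a constant $C$ (depending on $\tau_0$) and smooth functions $a,b$ of $(\tilde d,\lambda)=(\tilde d_1,\tilde d_2,\lambda)$ on $\{|\tilde d|<\delta_1,\ |\lambda|<\delta_0\}$ with the following properties. 1. For each $|\lambda|<\delta_0$, the set $$\mathcal W_-^{cu}(\lambda)=\Big\{U\in C^0([0,\tau_0],\mathbb R^4)\text{ solving (1) on }(0,\tau_0]\ :\ \sup_{0\le\tau\le\tau_0}|U(\tau)|<\delta_0\Big\}$$ is a smooth two-dimensional submanifold of $C^0([0,\tau_0],\mathbb R^4)$. 2. Let $|\lambda|<\delta_0$ and $|\tilde d|<\delta_1$. A solution $U\in C^0([0,\tau_0],\mathbb R^4)$ of (1) belongs to $\mathcal W_-^{cu}(\lambda)$ and satisfies $P_-^{cu}(\tau_0)U(\tau_0)=\tilde d_1V_1(\tau_0)+\tilde d_2V_2(\tau_0)$ if and only if $$U(\tau_0)=\tilde d_1V_1(\tau_0)+\tilde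 d_2V_2(\tau_0)+b(\tilde d,\lambda)\,V_3(\tau_0)+a(\tilde d,\lambda)\,V_4(\tau_0),\tag{2}$$ and there is a $U\in\mathcal W_-^{cu}(\lambda)$ satisfying (2). 3. For all $|\lambda|<\delta_0$ and $|\tilde d|<\delta_1$, $$|b(\tilde d,\lambda)|\le C\,(|\lambda||\tilde d|+|\tilde d|^2),$$ $$\big|a(\tilde d,\lambda)+(\mathcal I+\rho(\tau_0))\,\nu\,\tilde d_1^2\big|\le C\,\big(|\lambda||\tilde d|+|\tilde d_1||\tilde d_2|+|\tilde d_2|^2+|\tilde d_1|^3\big),$$ $$\big|a(\tilde d,\lambda)+\mathcal I\,\nu\,\tilde d_1^2\big|\le \varepsilon(\tau_0)\,|\nu|\,\tilde d_1^2+C\,\big(|\lambda||\tilde d|+|\tilde d_2|^2+|\tilde d_1|^3\big).$$ -/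

import Mathlib

open Set Filter Topology MeasureTheory
open scoped ContDiff

noncomputable section

namespace HyperbolicSH

/-- Legendre function of the first kind of complex degree `α`, at real `z ≥ 1`
(Laplace's first integral). -/
def legendreP (α : ℂ) (z : ℝ) : ℂ :=
  (1 / Real.pi : ℂ) * ∫ θ in (0 : ℝ)..Real.pi,
    ((z + Real.sqrt (z ^ 2 - 1) * Real.cos θ : ℝ) : ℂ) ^ α

/-- Legendre function of the second kind of complex degree `α` with `Re α > -1`, at real `z > 1`
(Heine's integral). -/
def legendreQ (α : ℂ) (z : ℝ) : ℂ :=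
  ∫ t in Ioi (0 : ℝ), ((z + Real.sqrt (z ^ 2 - 1) * Real.cosh t : ℝ) : ℂ) ^ (-α - 1)

/-- Associated Legendre function of the first kind of order one, at `z > 1`. -/
def legendreP1 (α : ℂ) (z : ℝ) : ℂ := (Real.sqrt (z ^ 2 - 1) : ℂ) * deriv (legendreP α) z

/-- Associated Legendre function of the second kind of order one, at `z > 1`. -/
def legendreQ1 (α : ℂ) (z : ℝ) : ℂ := (Real.sqrt (z ^ 2 - 1) : ℂ) * deriv (legendreQ α) z

/-- The degree `α₀ = -1/2 + i √3/2`, a root of `α (α + 1) = -1`. -/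
def alpha0 : ℂ := -1 / 2 + Complex.I * ((Real.sqrt 3 : ℝ) : ℂ) / 2

/-- `P_{α₀}(cosh τ)`. The complex number `legendreP alpha0 (cosh τ)` is real, so taking the real
part only changes the codomain. -/
def pc (τ : ℝ) : ℝ := (legendreP alpha0 (Real.cosh τ)).re

/-- `P¹_{α₀}(cosh τ)`. -/
def pc1 (τ : ℝ) : ℝ := (legendreP1 alpha0 (Real.cosh τ)).re

/-- `Q_{α₀}(cosh τ)`, in its real normalization: the real part of the Legendre function of the
second kind. -/
def qc (τ : ℝ) : ℝ := (legendreQ alpha0 (Real.cosh τ)).re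

/-- `Q¹_{α₀}(cosh τ)`, in the same real normalization. -/
def qc1 (τ : ℝ) : ℝ := (legendreQ1 alpha0 (Real.cosh τ)).re

/-- The phase space `ℝ⁴` with its Euclidean norm. -/
abbrev E4 := EuclideanSpace ℝ (Fin 4)

/-- The parameter space `ℝ²` with its Euclidean norm. -/
abbrev E2 := EuclideanSpace ℝ (Fin 2)

/-- `∫₀^τ P_{α₀}(cosh s)² sinh s ds`. -/
def intPP (τ : ℝ) : ℝ := ∫ s in (0 : ℝ)..τ, pc s ^ 2 * Real.sinh s

/-- `∫₀^τ P_{α₀}(cosh s) Q_{α₀}(cosh s) sinh s ds`. -/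
def intPQ (τ : ℝ) : ℝ := ∫ s in (0 : ℝ)..τ, pc s * qc s * Real.sinh s

/-- `∫₀^τ Q_{α₀}(cosh s)² sinh s ds`. -/
def intQQ (τ : ℝ) : ℝ := ∫ s in (0 : ℝ)..τ, qc s ^ 2 * Real.sinh s

def V1 (τ : ℝ) : E4 := !₂[pc τ, 0, pc1 τ, 0]

def V2 (τ : ℝ) : E4 :=
  !₂[pc τ * intPQ τ - qc τ * intPP τ, pc τ, pc1 τ * intPQ τ - qc1 τ * intPP τ, pc1 τ]

def V3 (τ : ℝ) : E4 := !₂[qc τ, 0, qc1 τ, 0]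

def V4 (τ : ℝ) : E4 :=
  !₂[pc τ * intQQ τ - qc τ * intPQ τ, qc τ, pc1 τ * intQQ τ - qc1 τ * intPQ τ, qc1 τ]

/-- The frame `V₁(τ), V₂(τ), V₃(τ), V₄(τ)`. -/
def frame (τ : ℝ) : Fin 4 → E4 := ![V1 τ, V2 τ, V3 τ, V4 τ]

/-- The matrix with columns `V₁(τ), …, V₄(τ)`. -/
def frameMatrix (τ : ℝ) : Matrix (Fin 4) (Fin 4) ℝ := Matrix.of fun i j => frame τ j i

/-- When `V₁(τ), …, V₄(τ)` are linearly independent: the projection of `ℝ⁴` onto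
`span {V₁(τ), V₂(τ)}` with null space `span {V₃(τ), V₄(τ)}`. -/
def coreProj (τ : ℝ) : E4 →ₗ[ℝ] E4 :=
  (frameMatrix τ * Matrix.diagonal ![1, 1, 0, 0] * (frameMatrix τ)⁻¹).toEuclideanLin

/-- The matrix `A(τ)` of the linear part, with `coth τ = cosh τ / sinh τ`. -/
def coreA (τ : ℝ) : Matrix (Fin 4) (Fin 4) ℝ :=
  !![0, 0, 1, 0;
     0, 0, 0, 1;
     -1, 1, -(Real.cosh τ / Real.sinh τ), 0;
     0, -1, 0, -(Real.cosh τ / Real.sinh τ)]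

/-- The nonlinear term `F(U, λ)`. -/
def coreF (ν η lam : ℝ) (u : E4) : E4 :=
  !₂[0, 0, 0, lam * u 0 + ν * u 0 ^ 2 - η * u 0 ^ 3]

/-- `U ∈ C⁰([0, τ₀], ℝ⁴)` solves `U' = A(τ) U + F(U, λ)` on `(0, τ₀]`
(the derivative at `τ₀` is one-sided). -/
def IsCoreSolution (ν η lam : ℝ) {τ₀ : ℝ} (h : 0 < τ₀) (U : C(Icc (0 : ℝ) τ₀, E4)) : Prop :=
  ∀ τ : Icc (0 : ℝ) τ₀, 0 < (τ : ℝ) →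
    HasDerivWithinAt (Set.IccExtend h.le U)
      ((coreA τ).toEuclideanLin (U τ) + coreF ν η lam (U τ)) (Icc 0 τ₀) τ

/-- The set `W^{cu}_-(λ)`: continuous solutions on `[0, τ₀]` with
`sup_{0 ≤ τ ≤ τ₀} |U(τ)| < δ₀`. -/
def coreManifold (ν η lam : ℝ) {τ₀ : ℝ} (h : 0 < τ₀) (δ₀ : ℝ) : Set C(Icc (0 : ℝ) τ₀, E4) :=
  {U | IsCoreSolution ν η lam h U ∧ ‖U‖ < δ₀}

/-- `S` is an `n`-dimensional embedded smooth submanifold of the normed space `X`: near each of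
its points it is the image of an open subset of `ℝⁿ` under a smooth immersion that is a
homeomorphism onto its image. -/
def IsSmoothSubmanifold {X : Type*} [NormedAddCommGroup X] [NormedSpace ℝ X]
    (n : ℕ) (S : Set X) : Prop :=
  ∀ p ∈ S, ∃ (O : Set X) (D : Set (EuclideanSpace ℝ (Fin n)))
    (φ : EuclideanSpace ℝ (Fin n) → X) (ψ : X → EuclideanSpace ℝ (Fin n)),
    IsOpen O ∧ p ∈ O ∧ IsOpen D ∧
    ContDiffOn ℝ ∞ φ D ∧ (∀ y ∈ D, Function.Injective (fderiv ℝ φ y)) ∧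
    φ '' D = S ∩ O ∧ ContinuousOn ψ (S ∩ O) ∧ (∀ y ∈ D, ψ (φ y) = y)

/-- `𝓘 = ∫₀^∞ P_{α₀}(cosh s)³ sinh s ds`. -/
def calI : ℝ := ∫ s in Ioi (0 : ℝ), pc s ^ 3 * Real.sinh s

end HyperbolicSH

end

/-! Write L = ∂² + coth τ ∂ + 1. System (1) is triangular: L u₁ = u₂ and L u₂ = λu₁ + νu₁² - ηu₁³.
Since α₀(α₀+1) = -1, the functions P and Q(cosh τ) span the kernel of L on τ > 0. P is smooth at the
origin, while Q is singular there; the normalization is sinh τ (P¹Q - PQ¹) = 1 (`wronskian`), which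
needs the limits of Q sinh and Q¹ sinh at 0.

Continuity at τ = 0 excludes Q from the homogeneous part, so variation of constants gives y = xP +
P∫QF sinh - Q∫PF sinh for every solution of Ly = F that is continuous on [0, τ₀] together with y'
(`exists_eq_mul_pc_add_green`). Applied to u₂ and then to u₁, this turns (1) into U = T d +
K(cubic(u₁)), with T d a combination of V₁ and V₂, and K corrected so that d is the pair of V₁, V₂
coefficients at τ₀ (`isCoreSolution_iff_eq`). The inverse function theorem together with a
contraction estimate yields a smooth family Φ(d, λ) containing all small solutions
(`exists_cubic_fixedPoint`). The map U ↦ d is a continuous linear left inverse of Φ(·, λ), whence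
the submanifold. The functions b and a are the V₃ and V₄ coefficients of Φ at τ₀.

The V₄ coefficient is the coefficient of Q in u₂, namely -∫₀^{τ₀} P f sinh for the forcing f
(`endCoef_three_projectedSol`). Inserting u₁ = d₁P + d₂A + O(|λ||d| + |d|²) gives a = -ν d₁² ∫₀^{τ₀}
P³ sinh + ..., so ρ is the tail of the convergent integral 𝓘. Convergence follows from P =
O(e^{-τ/2}), obtained from a decreasing energy. The mixed term d₁d₂ is removed in the last estimate
by Young's inequality with a weight that tends to 0 as τ₀ → ∞.

In the converse direction of the endpoint characterization U is not known to be small, so uniqueness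
comes from a backward Grönwall argument (`IsCoreSolution.eq_of_endpoint`). -/

noncomputable section

namespace HyperbolicSH

/-! ### Differentiation of Laplace-type integrals under the integral sign. -/

/-- The base `cosh τ + sinh τ · c` of the Laplace-type integrands. -/
def lapBase (c τ : ℝ) : ℝ := Real.cosh τ + Real.sinh τ * c

/-- The derivative of `lapBase c` in `τ`. -/
def lapBase' (c τ : ℝ) : ℝ := Real.sinh τ + Real.cosh τ * c

/-- The Laplace-type integrand `(cosh τ + sinh τ · c) ^ β`. -/
def lapKernel (β : ℂ) (c τ : ℝ) : ℂ := (lapBase c τ : ℂ) ^ β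

/-- First `τ`-derivative of `lapKernel`. -/
def lapKernel₁ (β : ℂ) (c τ : ℝ) : ℂ :=
  β * lapKernel β c τ * ((lapBase' c τ / lapBase c τ : ℝ) : ℂ)

/-- Second `τ`-derivative of `lapKernel`. -/
def lapKernel₂ (β : ℂ) (c τ : ℝ) : ℂ :=
  β * lapKernel β c τ * ((β - 1) * ((lapBase' c τ / lapBase c τ : ℝ) : ℂ) ^ 2 + 1)

theorem hasDerivAt_lapBase (c τ : ℝ) : HasDerivAt (lapBase c) (lapBase' c τ) τ :=
  (Real.hasDerivAt_cosh τ).add ((Real.hasDerivAt_sinh τ).mul_const c)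

theorem hasDerivAt_lapBase' (c τ : ℝ) : HasDerivAt (lapBase' c) (lapBase c τ) τ :=
  (Real.hasDerivAt_sinh τ).add ((Real.hasDerivAt_cosh τ).mul_const c)

/-- The logarithmic form keeps every derivative a multiple of the kernel itself, so that bounds
reduce to the real ratio f'/f. -/
theorem hasDerivAt_ofReal_cpow {f : ℝ → ℝ} {f' x : ℝ} (β : ℂ) (hf : HasDerivAt f f' x)
    (hx : 0 < f x) :
    HasDerivAt (fun y => (f y : ℂ) ^ β) (β * (f x : ℂ) ^ β * ((f' / f x : ℝ) : ℂ)) x := by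
  have h1 : HasDerivAt (fun y => (f y : ℂ)) (f' : ℂ) x := hf.ofReal_comp
  have h2 := (hasDerivAt_id (f x : ℂ)).cpow_const (c := β) (Or.inl (by simpa using hx))
  refine (h2.comp x h1).congr_deriv ?_
  have h0 : (f x : ℂ) ≠ 0 := by exact_mod_cast hx.ne'
  simp only [id, Complex.cpow_sub _ _ h0, Complex.cpow_one]
  push_cast
  field_simp

theorem norm_lapKernel (β : ℂ) {c τ : ℝ} (h : 0 < lapBase c τ) :
    ‖lapKernel β c τ‖ = lapBase c τ ^ β.re :=
  Complex.norm_cpow_eq_rpow_re_of_pos h β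

theorem hasDerivAt_lapKernel (β : ℂ) {c τ : ℝ} (h : 0 < lapBase c τ) :
    HasDerivAt (lapKernel β c) (lapKernel₁ β c τ) τ :=
  hasDerivAt_ofReal_cpow β (hasDerivAt_lapBase c τ) h

theorem hasDerivAt_lapKernel₁ (β : ℂ) {c τ : ℝ} (h : 0 < lapBase c τ) :
    HasDerivAt (lapKernel₁ β c) (lapKernel₂ β c τ) τ := by
  have hr := ((hasDerivAt_lapBase' c τ).div (hasDerivAt_lapBase c τ) h.ne').ofReal_comp
  refine (((hasDerivAt_lapKernel β h).const_mul β).mul hr).congr_deriv ?_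
  have h0 : (lapBase c τ : ℂ) ≠ 0 := by exact_mod_cast h.ne'
  unfold lapKernel₂
  simp only [Pi.div_apply]
  unfold lapKernel₁
  push_cast
  field_simp
  ring

theorem abs_lapBase'_div {c τ K : ℝ} (h : 0 < lapBase c τ) (hK : |lapBase' c τ| ≤ K * lapBase c τ) :
    ‖((lapBase' c τ / lapBase c τ : ℝ) : ℂ)‖ ≤ K := by
  rw [Complex.norm_real, Real.norm_eq_abs, abs_div, abs_of_pos h, div_le_iff₀ h]
  exact hK

theorem norm_lapKernel₁_le (β : ℂ) {c τ K : ℝ} (h : 0 < lapBase c τ)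
    (hK : |lapBase' c τ| ≤ K * lapBase c τ) :
    ‖lapKernel₁ β c τ‖ ≤ ‖β‖ * K * lapBase c τ ^ β.re := by
  rw [lapKernel₁, norm_mul, norm_mul, norm_lapKernel β h]
  have := abs_lapBase'_div h hK
  have h2 := Real.rpow_nonneg h.le β.re
  calc _ ≤ ‖β‖ * lapBase c τ ^ β.re * K := by gcongr
    _ = _ := by ring

theorem norm_lapKernel₂_le (β : ℂ) {c τ K : ℝ} (h : 0 < lapBase c τ)
    (hK : |lapBase' c τ| ≤ K * lapBase c τ) :
    ‖lapKernel₂ β c τ‖ ≤ ‖β‖ * (‖β - 1‖ * K ^ 2 + 1) * lapBase c τ ^ β.re := by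
  rw [lapKernel₂, norm_mul, norm_mul, norm_lapKernel β h]
  have := abs_lapBase'_div h hK
  have h2 := Real.rpow_nonneg h.le β.re
  have h3 : ‖(β - 1) * ((lapBase' c τ / lapBase c τ : ℝ) : ℂ) ^ 2 + 1‖ ≤ ‖β - 1‖ * K ^ 2 + 1 := by
    refine (norm_add_le _ _).trans ?_
    rw [norm_mul, norm_pow, norm_one]
    gcongr
  calc _ ≤ ‖β‖ * lapBase c τ ^ β.re * (‖β - 1‖ * K ^ 2 + 1) := by gcongr
    _ = _ := by ring

theorem continuous_lapKernel {c : ℝ → ℝ} (hc : Continuous c) (β : ℂ) {τ : ℝ}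
    (h : ∀ s, 0 < lapBase (c s) τ) : Continuous fun s => lapKernel β (c s) τ := by
  unfold lapKernel
  have h1 : Continuous fun s => (lapBase (c s) τ : ℂ) := by unfold lapBase; fun_prop
  exact h1.cpow continuous_const fun s => Or.inl (by simpa using h s)

theorem continuous_lapBase'_div {c : ℝ → ℝ} (hc : Continuous c) {τ : ℝ}
    (h : ∀ s, 0 < lapBase (c s) τ) :
    Continuous fun s => ((lapBase' (c s) τ / lapBase (c s) τ : ℝ) : ℂ) := by
  refine Complex.continuous_ofReal.comp (Continuous.div ?_ ?_ fun s => (h s).ne')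
  · unfold lapBase'; fun_prop
  · unfold lapBase; fun_prop

theorem continuous_lapKernel₁ {c : ℝ → ℝ} (hc : Continuous c) (β : ℂ) {τ : ℝ}
    (h : ∀ s, 0 < lapBase (c s) τ) : Continuous fun s => lapKernel₁ β (c s) τ :=
  (continuous_const.mul (continuous_lapKernel hc β h)).mul (continuous_lapBase'_div hc h)

theorem continuous_lapKernel₂ {c : ℝ → ℝ} (hc : Continuous c) (β : ℂ) {τ : ℝ}
    (h : ∀ s, 0 < lapBase (c s) τ) : Continuous fun s => lapKernel₂ β (c s) τ :=
  (continuous_const.mul (continuous_lapKernel hc β h)).mul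
    ((continuous_const.mul ((continuous_lapBase'_div hc h).pow 2)).add continuous_const)

/-- Local domination of the Laplace-type integrands near `τ₀`. -/
structure LapDominated (μ : Measure ℝ) (c : ℝ → ℝ) (r τ₀ : ℝ) where
  S : Set ℝ
  K : ℝ
  g : ℝ → ℝ
  cont : Continuous c
  mem : S ∈ 𝓝 τ₀
  pos : ∀ s, ∀ τ ∈ S, 0 < lapBase (c s) τ
  bound : ∀ s, ∀ τ ∈ S, |lapBase' (c s) τ| ≤ K * lapBase (c s) τ
  le : ∀ s, ∀ τ ∈ S, lapBase (c s) τ ^ r ≤ g s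
  integrable : Integrable g μ

namespace LapDominated

variable {μ : Measure ℝ} {c : ℝ → ℝ} {β : ℂ} {τ₀ : ℝ}

theorem K_nonneg (H : LapDominated μ c β.re τ₀) : 0 ≤ H.K := by
  have h := H.bound 0 τ₀ (mem_of_mem_nhds H.mem)
  have h2 := H.pos 0 τ₀ (mem_of_mem_nhds H.mem)
  by_contra hK
  nlinarith [abs_nonneg (lapBase' (c 0) τ₀)]

theorem integrable_kernel (H : LapDominated μ c β.re τ₀) :
    Integrable (fun s => lapKernel β (c s) τ₀) μ := by
  have hm := mem_of_mem_nhds H.mem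
  refine H.integrable.mono'
    (continuous_lapKernel H.cont β fun s => H.pos s _ hm).aestronglyMeasurable ?_
  refine ae_of_all _ fun s => ?_
  rw [norm_lapKernel β (H.pos s _ hm)]
  exact H.le s _ hm

theorem hasDerivAt_integral (H : LapDominated μ c β.re τ₀) :
    Integrable (fun s => lapKernel₁ β (c s) τ₀) μ ∧
    HasDerivAt (fun τ => ∫ s, lapKernel β (c s) τ ∂μ) (∫ s, lapKernel₁ β (c s) τ₀ ∂μ) τ₀ := by
  have hm := mem_of_mem_nhds H.mem
  refine hasDerivAt_integral_of_dominated_loc_of_deriv_le (F := fun τ s => lapKernel β (c s) τ)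
    (F' := fun τ s => lapKernel₁ β (c s) τ) (bound := fun s => ‖β‖ * H.K * H.g s) H.mem ?_
    H.integrable_kernel ?_ ?_ (H.integrable.const_mul _) ?_
  · filter_upwards [H.mem] with τ hτ
    exact (continuous_lapKernel H.cont β fun s => H.pos s _ hτ).aestronglyMeasurable
  · exact (continuous_lapKernel₁ H.cont β fun s => H.pos s _ hm).aestronglyMeasurable
  · refine ae_of_all _ fun s τ hτ => (norm_lapKernel₁_le β (H.pos s τ hτ) (H.bound s τ hτ)).trans ?_
    exact mul_le_mul_of_nonneg_left (H.le s τ hτ) (mul_nonneg (norm_nonneg _) H.K_nonneg)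
  · exact ae_of_all _ fun s τ hτ => hasDerivAt_lapKernel β (H.pos s τ hτ)

theorem hasDerivAt_integral₁ (H : LapDominated μ c β.re τ₀) :
    Integrable (fun s => lapKernel₂ β (c s) τ₀) μ ∧
    HasDerivAt (fun τ => ∫ s, lapKernel₁ β (c s) τ ∂μ) (∫ s, lapKernel₂ β (c s) τ₀ ∂μ) τ₀ := by
  have hm := mem_of_mem_nhds H.mem
  refine hasDerivAt_integral_of_dominated_loc_of_deriv_le (F := fun τ s => lapKernel₁ β (c s) τ)
    (F' := fun τ s => lapKernel₂ β (c s) τ)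
    (bound := fun s => ‖β‖ * (‖β - 1‖ * H.K ^ 2 + 1) * H.g s) H.mem ?_
    H.hasDerivAt_integral.1 ?_ ?_ (H.integrable.const_mul _) ?_
  · filter_upwards [H.mem] with τ hτ
    exact (continuous_lapKernel₁ H.cont β fun s => H.pos s _ hτ).aestronglyMeasurable
  · exact (continuous_lapKernel₂ H.cont β fun s => H.pos s _ hm).aestronglyMeasurable
  · refine ae_of_all _ fun s τ hτ => (norm_lapKernel₂_le β (H.pos s τ hτ) (H.bound s τ hτ)).trans ?_
    exact mul_le_mul_of_nonneg_left (H.le s τ hτ) (by positivity)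
  · exact ae_of_all _ fun s τ hτ => hasDerivAt_lapKernel₁ β (H.pos s τ hτ)

end LapDominated

/-! ### The Legendre equation for P and Q in the variable τ. -/

/-- The Legendre operator applied to the integrand is a total derivative in the angle. -/
theorem hasDerivAt_lapKernel_angle (β : ℂ) {c e : ℝ → ℝ} {κ s τ : ℝ} (hc : HasDerivAt c (e s) s)
    (he : HasDerivAt e (κ * c s) s) (hκ : κ ^ 2 = 1) (hce : κ * e s ^ 2 = c s ^ 2 - 1)
    (hpos : 0 < lapBase (c s) τ) (hτ : Real.sinh τ ≠ 0) :
    HasDerivAt (fun x => β * lapKernel β (c x) τ * ((κ * e x / lapBase (c x) τ : ℝ) : ℂ))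
      (Real.sinh τ * (lapKernel₂ β (c s) τ
        + (Real.cosh τ / Real.sinh τ : ℝ) * lapKernel₁ β (c s) τ
        - β * (β + 1) * lapKernel β (c s) τ)) s := by
  have hb : HasDerivAt (fun x => lapBase (c x) τ) (Real.sinh τ * e s) s :=
    (hc.const_mul (Real.sinh τ)).const_add (Real.cosh τ)
  have h1 := hasDerivAt_ofReal_cpow β hb hpos
  have h2 := ((he.const_mul κ).div hb hpos.ne').ofReal_comp
  refine ((h1.const_mul β).mul h2).congr_deriv ?_
  have h0 : (lapBase (c s) τ : ℂ) ≠ 0 := by exact_mod_cast hpos.ne'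
  have h0' : (Real.sinh τ : ℂ) ≠ 0 := by exact_mod_cast hτ
  -- The sign κ treats both integrals at once: κ = -1 for (cos, -sin), κ = 1 for (cosh, sinh).
  have hκ' : (κ : ℂ) ^ 2 = 1 := by exact_mod_cast hκ
  have hce' : (κ : ℂ) * (e s : ℂ) ^ 2 = (c s : ℂ) ^ 2 - 1 := by exact_mod_cast hce
  have hcs : (Real.cosh τ : ℂ) ^ 2 = (Real.sinh τ : ℂ) ^ 2 + 1 := by
    exact_mod_cast Real.cosh_sq τ
  unfold lapKernel₂ lapKernel₁
  change β * (β * lapKernel β (c s) τ * _) * _ + β * lapKernel β (c s) τ * _ = _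
  have hX : (lapBase (c s) τ : ℂ) = Real.cosh τ + Real.sinh τ * c s := by
    simp [lapBase]
  have hX' : (lapBase' (c s) τ : ℂ) = Real.sinh τ + Real.cosh τ * c s := by
    simp [lapBase']
  simp only [Pi.div_apply, Complex.ofReal_div, Complex.ofReal_mul, Complex.ofReal_sub, Complex.ofReal_pow]
  generalize lapKernel β (c s) τ = k
  generalize (lapBase' (c s) τ : ℂ) = Y at *
  generalize hXg : (lapBase (c s) τ : ℂ) = X at *
  generalize (Real.sinh τ : ℂ) = S at *
  generalize (Real.cosh τ : ℂ) = C at *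
  generalize (c s : ℂ) = z at *
  generalize (e s : ℂ) = w at *
  generalize (κ : ℂ) = q at *
  field_simp
  have e1 : Y ^ 2 = X ^ 2 + (z ^ 2 - 1) := by
    rw [hX, hX']; linear_combination (z ^ 2 - 1) * hcs
  have e2 : C * Y = S * X + z := by
    rw [hX, hX']; linear_combination z * hcs
  linear_combination β * k * ((β - 1) * S * hce' + X * z * hκ' - S * (β - 1) * e1 - X * e2)

theorem sqrt_cosh_sq_sub_one {τ : ℝ} (h : 0 ≤ τ) :
    Real.sqrt (Real.cosh τ ^ 2 - 1) = Real.sinh τ := by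
  rw [Real.cosh_sq, add_sub_cancel_right, Real.sqrt_sq (Real.sinh_nonneg_iff.2 h)]

/-- At z = cosh τ the operator √(z²-1) d/dz is d/dτ, so P¹ and Q¹ are the τ-derivatives of P and Q.
-/
theorem sqrt_mul_deriv_cosh {f F : ℝ → ℂ} (hf : ∀ τ, 0 < τ → f (Real.cosh τ) = F τ) {τ : ℝ} {F' : ℂ}
    (hτ : 0 < τ) (hF : HasDerivAt F F' τ) :
    (Real.sqrt (Real.cosh τ ^ 2 - 1) : ℂ) * deriv f (Real.cosh τ) = F' := by
  have h1 : 1 < Real.cosh τ := Real.one_lt_cosh.2 hτ.ne'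
  have hs : 0 < Real.sinh τ := Real.sinh_pos_iff.2 hτ
  have ha := Real.hasDerivAt_arcosh (x := Real.cosh τ) h1
  rw [sqrt_cosh_sq_sub_one hτ.le] at ha ⊢
  rw [← Real.arcosh_cosh hτ.le] at hF
  have hcomp := hF.scomp (Real.cosh τ) ha
  have heq : f =ᶠ[𝓝 (Real.cosh τ)] F ∘ Real.arcosh := by
    filter_upwards [lt_mem_nhds h1] with z hz
    rw [Function.comp, ← hf _ (Real.arcosh_pos hz), Real.cosh_arcosh hz.le]
  rw [(hcomp.congr_of_eventuallyEq heq).deriv]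
  have : (Real.sinh τ : ℂ) ≠ 0 := by exact_mod_cast hs.ne'
  rw [Complex.real_smul, Complex.ofReal_inv, mul_inv_cancel_left₀ this]

theorem alpha0_re : alpha0.re = -(1 / 2) := by
  simp [alpha0]; norm_num

theorem alpha0_mul : alpha0 * (alpha0 + 1) = -1 := by
  have h3 : ((Real.sqrt 3 : ℝ) : ℂ) ^ 2 = 3 := by
    exact_mod_cast Real.sq_sqrt (by norm_num : (0 : ℝ) ≤ 3)
  unfold alpha0
  linear_combination (1 / 4) * Complex.I ^ 2 * h3 + (3 / 4) * Complex.I_sq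

/-- The exponent in Heine's integral. -/
def beta0 : ℂ := -alpha0 - 1

theorem beta0_re : beta0.re = -(1 / 2) := by
  simp [beta0, alpha0_re]; norm_num

theorem beta0_mul : beta0 * (beta0 + 1) = -1 := by
  unfold beta0; linear_combination alpha0_mul

theorem exp_neg_abs_le_lapBase (θ τ : ℝ) : Real.exp (-|τ|) ≤ lapBase (Real.cos θ) τ := by
  have h1 : Real.exp (-|τ|) = Real.cosh τ - |Real.sinh τ| := by
    rw [← Real.cosh_abs, Real.abs_sinh, Real.cosh_sub_sinh]
  have h2 := abs_mul (Real.sinh τ) (Real.cos θ)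
  have h3 := neg_abs_le (Real.sinh τ * Real.cos θ)
  have h4 := mul_le_of_le_one_right (abs_nonneg (Real.sinh τ)) (Real.abs_cos_le_one θ)
  rw [h1, lapBase]; linarith

/-- With c = cos θ, the base minus its derivative is e^{-τ}(1-c) and their sum is e^{τ}(1+c); both
are nonnegative. -/
theorem abs_lapBase'_cos_le (θ τ : ℝ) :
    |lapBase' (Real.cos θ) τ| ≤ 1 * lapBase (Real.cos θ) τ := by
  have h1 := Real.exp_pos τ
  have h2 := Real.exp_pos (-τ)
  rw [← Real.cosh_add_sinh] at h1
  rw [← Real.cosh_sub_sinh] at h2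
  have h3 := Real.neg_one_le_cos θ
  have h4 := Real.cos_le_one θ
  rw [one_mul, abs_le, lapBase, lapBase']
  constructor <;> nlinarith

/-- Domination for the integral defining `P`. -/
def lapDominatedCos (τ₀ : ℝ) :
    LapDominated (volume.restrict (Ioc 0 Real.pi)) Real.cos alpha0.re τ₀ where
  S := Ioo (τ₀ - 1) (τ₀ + 1)
  K := 1
  -- The base is at least e^{-|τ|} ≥ e^{-(|τ₀|+1)}, and the exponent is negative.
  g := fun _ => Real.exp (-(|τ₀| + 1)) ^ (-(1 / 2) : ℝ)
  cont := Real.continuous_cos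
  mem := Ioo_mem_nhds (by linarith) (by linarith)
  pos := fun s τ _ => (Real.exp_pos _).trans_le (exp_neg_abs_le_lapBase s τ)
  bound := fun s τ _ => abs_lapBase'_cos_le s τ
  le := fun s τ hτ => by
    rw [alpha0_re]
    refine Real.rpow_le_rpow_of_nonpos (Real.exp_pos _) ?_ (by norm_num)
    refine le_trans (Real.exp_le_exp.2 ?_) (exp_neg_abs_le_lapBase s τ)
    have h1 : |τ - τ₀| ≤ 1 := abs_le.2 ⟨by linarith [hτ.1], by linarith [hτ.2]⟩
    have h2 := abs_sub_abs_le_abs_sub τ τ₀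
    linarith
  integrable := by simp

theorem lapBase_cosh_ge {τ : ℝ} (hτ : 0 < τ) (s : ℝ) :
    Real.sinh τ / 2 * Real.exp s ≤ lapBase (Real.cosh s) τ := by
  have hs := Real.sinh_pos_iff.2 hτ
  have h1 := Real.cosh_pos τ
  have h2 : Real.exp s ≤ 2 * Real.cosh s := by
    rw [Real.cosh_eq]; linarith [Real.exp_pos (-s)]
  rw [lapBase]; nlinarith

theorem lapBase_cosh_pos {τ : ℝ} (hτ : 0 < τ) (s : ℝ) : 0 < lapBase (Real.cosh s) τ :=
  lt_of_lt_of_le (by have := Real.sinh_pos_iff.2 hτ; positivity) (lapBase_cosh_ge hτ s)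

/-- The difference of the two sides is exactly 1/sinh τ. -/
theorem abs_lapBase'_cosh_le {τ : ℝ} (hτ : 0 < τ) (s : ℝ) :
    |lapBase' (Real.cosh s) τ| ≤ Real.cosh τ / Real.sinh τ * lapBase (Real.cosh s) τ := by
  have hs := Real.sinh_pos_iff.2 hτ
  have h1 := Real.cosh_pos τ
  have h2 := Real.cosh_pos s
  have h3 := Real.cosh_sq τ
  rw [abs_of_nonneg (by rw [lapBase']; positivity), div_mul_eq_mul_div, le_div_iff₀ hs, lapBase,
    lapBase']
  nlinarith

theorem lapBase_cosh_rpow_le {σ τ : ℝ} (hσ : 0 < σ) (hτ : σ ≤ τ) (s : ℝ) :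
    lapBase (Real.cosh s) τ ^ (-(1 / 2) : ℝ) ≤
      (Real.sinh σ / 2) ^ (-(1 / 2) : ℝ) * Real.exp (-(1 / 2) * s) := by
  have hs := Real.sinh_pos_iff.2 hσ
  have h1 : Real.sinh σ / 2 * Real.exp s ≤ lapBase (Real.cosh s) τ :=
    le_trans (by have := Real.sinh_le_sinh.2 hτ; gcongr) (lapBase_cosh_ge (hσ.trans_le hτ) s)
  refine (Real.rpow_le_rpow_of_nonpos (by positivity) h1 (by norm_num)).trans ?_
  rw [Real.mul_rpow (by positivity) (Real.exp_pos _).le, ← Real.exp_mul, mul_comm s]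

theorem integrableOn_exp_neg_half : IntegrableOn (fun s : ℝ => Real.exp (-(1 / 2) * s)) (Ioi 0) :=
  exp_neg_integrableOn_Ioi 0 (by norm_num)

/-- Domination for the integral defining `Q`. -/
def lapDominatedCosh {τ₀ : ℝ} (h : 0 < τ₀) :
    LapDominated (volume.restrict (Ioi 0)) Real.cosh beta0.re τ₀ where
  S := Ioo (τ₀ / 2) (2 * τ₀)
  K := Real.cosh (2 * τ₀) / Real.sinh (τ₀ / 2)
  g := fun s => (Real.sinh (τ₀ / 2) / 2) ^ (-(1 / 2) : ℝ) * Real.exp (-(1 / 2) * s)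
  cont := Real.continuous_cosh
  mem := Ioo_mem_nhds (by linarith) (by linarith)
  pos := fun s τ hτ => lapBase_cosh_pos (by linarith [hτ.1]) s
  bound := fun s τ hτ => by
    have h0 : 0 < τ := by linarith [hτ.1]
    refine (abs_lapBase'_cosh_le h0 s).trans ?_
    have h1 := (lapBase_cosh_pos h0 s).le
    have h2 : 0 < Real.sinh (τ₀ / 2) := Real.sinh_pos_iff.2 (by linarith)
    have h3 : Real.sinh (τ₀ / 2) ≤ Real.sinh τ := Real.sinh_le_sinh.2 hτ.1.le
    have h4 : Real.cosh τ ≤ Real.cosh (2 * τ₀) :=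
      Real.cosh_le_cosh.2 (by rw [abs_of_pos h0, abs_of_pos (by linarith)]; exact hτ.2.le)
    have := Real.cosh_pos τ
    gcongr
  le := fun s τ hτ => by
    rw [beta0_re]
    exact lapBase_cosh_rpow_le (by linarith) hτ.1.le s
  integrable := integrableOn_exp_neg_half.const_mul _

/-- For the kernels `lapKernel`, `lapKernel₁`, `lapKernel₂`: `P_{α₀}(cosh τ)` and its first two
derivatives, as real functions on the whole line. -/
def pInt (k : ℂ → ℝ → ℝ → ℂ) (τ : ℝ) : ℝ :=
  ((1 / Real.pi : ℂ) * ∫ θ in Ioc 0 Real.pi, k alpha0 (Real.cos θ) τ).re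

/-- For the kernels `lapKernel`, `lapKernel₁`, `lapKernel₂`: `Q_{α₀}(cosh τ)` and its first two
derivatives at `τ > 0`. -/
def qInt (k : ℂ → ℝ → ℝ → ℂ) (τ : ℝ) : ℝ :=
  (∫ s in Ioi (0 : ℝ), k beta0 (Real.cosh s) τ).re

theorem legendreP_cosh {τ : ℝ} (h : 0 ≤ τ) : legendreP alpha0 (Real.cosh τ) =
    (1 / Real.pi : ℂ) * ∫ θ in Ioc 0 Real.pi, lapKernel alpha0 (Real.cos θ) τ := by
  rw [legendreP, sqrt_cosh_sq_sub_one h, intervalIntegral.integral_of_le Real.pi_pos.le]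
  rfl

theorem legendreQ_cosh {τ : ℝ} (h : 0 ≤ τ) : legendreQ alpha0 (Real.cosh τ) =
    ∫ s in Ioi (0 : ℝ), lapKernel beta0 (Real.cosh s) τ := by
  rw [legendreQ, sqrt_cosh_sq_sub_one h]
  rfl

theorem _root_.HasDerivAt.complex_re {F : ℝ → ℂ} {F' : ℂ} {τ : ℝ} (h : HasDerivAt F F' τ) :
    HasDerivAt (fun t => (F t).re) F'.re τ :=
  (Complex.reCLM.hasFDerivAt.comp_hasDerivAt τ h)

theorem hasDerivAt_pInt (τ : ℝ) : HasDerivAt (pInt lapKernel) (pInt lapKernel₁ τ) τ :=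
  ((lapDominatedCos τ).hasDerivAt_integral.2.const_mul _).complex_re

theorem hasDerivAt_pInt₁ (τ : ℝ) : HasDerivAt (pInt lapKernel₁) (pInt lapKernel₂ τ) τ :=
  ((lapDominatedCos τ).hasDerivAt_integral₁.2.const_mul _).complex_re

theorem hasDerivAt_qInt {τ : ℝ} (h : 0 < τ) : HasDerivAt (qInt lapKernel) (qInt lapKernel₁ τ) τ :=
  (lapDominatedCosh h).hasDerivAt_integral.2.complex_re

theorem hasDerivAt_qInt₁ {τ : ℝ} (h : 0 < τ) :
    HasDerivAt (qInt lapKernel₁) (qInt lapKernel₂ τ) τ :=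
  (lapDominatedCosh h).hasDerivAt_integral₁.2.complex_re

theorem pc_eq {τ : ℝ} (h : 0 ≤ τ) : pc τ = pInt lapKernel τ := by
  rw [pc, legendreP_cosh h, pInt]

theorem qc_eq {τ : ℝ} (h : 0 ≤ τ) : qc τ = qInt lapKernel τ := by
  rw [qc, legendreQ_cosh h, qInt]

theorem pc1_eq_of_pos {τ : ℝ} (h : 0 < τ) : pc1 τ = pInt lapKernel₁ τ := by
  rw [pc1, legendreP1, sqrt_mul_deriv_cosh (fun t ht => legendreP_cosh ht.le) h
    ((lapDominatedCos τ).hasDerivAt_integral.2.const_mul _), pInt]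

theorem qc1_eq {τ : ℝ} (h : 0 < τ) : qc1 τ = qInt lapKernel₁ τ := by
  rw [qc1, legendreQ1, sqrt_mul_deriv_cosh (fun t ht => legendreQ_cosh ht.le) h
    (lapDominatedCosh h).hasDerivAt_integral.2, qInt]

theorem pInt_zero : pInt lapKernel 0 = 1 := by
  have : ∀ θ, lapKernel alpha0 (Real.cos θ) 0 = 1 := fun θ => by simp [lapKernel, lapBase]
  simp only [pInt, this]
  have hpi : (Real.pi : ℂ) ≠ 0 := by exact_mod_cast Real.pi_ne_zero
  simp [Real.pi_pos.le, hpi]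

theorem pInt₁_zero : pInt lapKernel₁ 0 = 0 := by
  have : ∀ θ, lapKernel₁ alpha0 (Real.cos θ) 0 = alpha0 * ((Real.cos θ : ℝ) : ℂ) := fun θ => by
    simp [lapKernel₁, lapKernel, lapBase, lapBase']
  simp only [pInt, this]
  rw [integral_const_mul, integral_complex_ofReal, ← intervalIntegral.integral_of_le Real.pi_pos.le]
  simp

theorem pc1_eq {τ : ℝ} (h : 0 ≤ τ) : pc1 τ = pInt lapKernel₁ τ := by
  rcases h.eq_or_lt with rfl | h
  · simp [pInt₁_zero, pc1, legendreP1]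
  · exact pc1_eq_of_pos h

/-- Shared by P (w = 1/π) and Q (w = 1): β(β+1) = -1 turns the Legendre equation into u'' + coth τ
u' + u = 0, a real equation that passes to real parts. -/
theorem re_ode_of_integral_eq_zero {μ : Measure ℝ} {c : ℝ → ℝ} {β w : ℂ} {τ : ℝ}
    (H : LapDominated μ c β.re τ) (hβ : β * (β + 1) = -1)
    (h0 : ∫ s, (Real.sinh τ * (lapKernel₂ β (c s) τ
        + (Real.cosh τ / Real.sinh τ : ℝ) * lapKernel₁ β (c s) τ
        - β * (β + 1) * lapKernel β (c s) τ) : ℂ) ∂μ = 0) (hτ : Real.sinh τ ≠ 0) :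
    (w * ∫ s, lapKernel₂ β (c s) τ ∂μ).re = -(w * ∫ s, lapKernel β (c s) τ ∂μ).re
      - Real.cosh τ / Real.sinh τ * (w * ∫ s, lapKernel₁ β (c s) τ ∂μ).re := by
  rw [integral_const_mul, hβ] at h0
  have hI1 : Integrable (fun s => lapKernel₂ β (c s) τ
      + (Real.cosh τ / Real.sinh τ : ℝ) * lapKernel₁ β (c s) τ) μ :=
    H.hasDerivAt_integral₁.1.add (H.hasDerivAt_integral.1.const_mul _)
  rw [integral_sub hI1
    (H.integrable_kernel.const_mul _), integral_add H.hasDerivAt_integral₁.1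
    (H.hasDerivAt_integral.1.const_mul _), integral_const_mul, integral_const_mul] at h0
  have hs : (Real.sinh τ : ℂ) ≠ 0 := by exact_mod_cast hτ
  have h1 := (mul_eq_zero.1 h0).resolve_left hs
  have h2 : w * ∫ s, lapKernel₂ β (c s) τ ∂μ = -(w * ∫ s, lapKernel β (c s) τ ∂μ)
      - (Real.cosh τ / Real.sinh τ : ℝ) * (w * ∫ s, lapKernel₁ β (c s) τ ∂μ) := by
    linear_combination w * h1
  rw [h2, Complex.sub_re, Complex.neg_re, Complex.re_ofReal_mul]

theorem continuous_ode_integrand {c : ℝ → ℝ} (hc : Continuous c) (β : ℂ) {τ : ℝ}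
    (h : ∀ s, 0 < lapBase (c s) τ) :
    Continuous fun s => (Real.sinh τ * (lapKernel₂ β (c s) τ
        + (Real.cosh τ / Real.sinh τ : ℝ) * lapKernel₁ β (c s) τ
        - β * (β + 1) * lapKernel β (c s) τ) : ℂ) :=
  continuous_const.mul (((continuous_lapKernel₂ hc β h).add
    (continuous_const.mul (continuous_lapKernel₁ hc β h))).sub
    (continuous_const.mul (continuous_lapKernel hc β h)))

theorem pInt₂_eq {τ : ℝ} (h : 0 < τ) :
    pInt lapKernel₂ τ = -pInt lapKernel τ - Real.cosh τ / Real.sinh τ * pInt lapKernel₁ τ := by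
  have hs := (Real.sinh_pos_iff.2 h).ne'
  have hp : ∀ θ, 0 < lapBase (Real.cos θ) τ := fun θ =>
    (Real.exp_pos _).trans_le (exp_neg_abs_le_lapBase θ τ)
  refine re_ode_of_integral_eq_zero (lapDominatedCos τ) alpha0_mul ?_ hs
  -- The total derivative integrates to zero because sin vanishes at 0 and π.
  rw [← intervalIntegral.integral_of_le Real.pi_pos.le,
    intervalIntegral.integral_eq_sub_of_hasDerivAt (f := fun x => alpha0 *
      lapKernel alpha0 (Real.cos x) τ *
      ((-1 * -Real.sin x / lapBase (Real.cos x) τ : ℝ) : ℂ)) ?_ ?_]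
  · simp
  · intro x _
    refine hasDerivAt_lapKernel_angle (e := fun x => -Real.sin x) (κ := -1) alpha0
      (Real.hasDerivAt_cos x) ?_ (by norm_num) ?_ (hp x) hs
    · exact (Real.hasDerivAt_sin x).neg.congr_deriv (by ring)
    · have := Real.sin_sq_add_cos_sq x
      linarith [this, neg_sq (Real.sin x)]
  · exact (continuous_ode_integrand Real.continuous_cos _ hp).intervalIntegrable _ _

theorem qInt₂_eq {τ : ℝ} (h : 0 < τ) :
    qInt lapKernel₂ τ = -qInt lapKernel τ - Real.cosh τ / Real.sinh τ * qInt lapKernel₁ τ := by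
  have hs' := Real.sinh_pos_iff.2 h
  have hs := hs'.ne'
  have hp := lapBase_cosh_pos h
  have H := lapDominatedCosh h
  have key := re_ode_of_integral_eq_zero (w := 1) H beta0_mul ?_ hs
  · simpa only [one_mul] using! key
  -- The boundary term vanishes at 0 because sinh 0 = 0, and at infinity because the kernel is
  -- O(e^{-x/2}) while the remaining factor is bounded.
  rw [integral_Ioi_of_hasDerivAt_of_tendsto' (m := 0) (f := fun x => beta0 *
      lapKernel beta0 (Real.cosh x) τ *
      ((1 * Real.sinh x / lapBase (Real.cosh x) τ : ℝ) : ℂ)) ?_ ?_ ?_]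
  · simp
  · intro x _
    refine hasDerivAt_lapKernel_angle (e := Real.sinh) (κ := 1) beta0
      (Real.hasDerivAt_cosh x) ?_ (by norm_num) ?_ (hp x) hs
    · simpa using Real.hasDerivAt_sinh x
    · rw [Real.cosh_sq]; ring
  · exact ((H.hasDerivAt_integral₁.1.add (H.hasDerivAt_integral.1.const_mul _)).sub
      (H.integrable_kernel.const_mul _)).const_mul _
  · have hlim : Tendsto (fun x : ℝ => ‖beta0‖ * ((Real.sinh τ / 2) ^ (-(1 / 2) : ℝ) *
        Real.exp (-(1 / 2) * x)) * (1 / Real.sinh τ)) atTop (𝓝 0) := by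
      have h1 : Tendsto (fun x : ℝ => Real.exp (-(1 / 2) * x)) atTop (𝓝 0) :=
        Real.tendsto_exp_atBot.comp
          (tendsto_id.const_mul_atTop_of_neg (by norm_num : (-(1 / 2) : ℝ) < 0))
      simpa using ((h1.const_mul ((Real.sinh τ / 2) ^ (-(1 / 2) : ℝ))).const_mul ‖beta0‖).mul_const
        (1 / Real.sinh τ)
    refine squeeze_zero_norm (fun x => ?_) hlim
    rw [norm_mul, norm_mul, norm_lapKernel _ (hp x), beta0_re, Complex.norm_real]
    have h1 := lapBase_cosh_rpow_le h le_rfl x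
    have h2 : ‖1 * Real.sinh x / lapBase (Real.cosh x) τ‖ ≤ 1 / Real.sinh τ := by
      rw [one_mul, norm_div, Real.norm_eq_abs, Real.norm_eq_abs, abs_of_pos (hp x),
        div_le_div_iff₀ (hp x) hs', lapBase]
      have h3 : |Real.sinh x| ≤ Real.cosh x := by
        rw [Real.abs_sinh, ← Real.cosh_abs]; exact (Real.sinh_lt_cosh _).le
      nlinarith [Real.cosh_pos τ]
    have := Real.rpow_nonneg (hp x).le (-(1 / 2))
    gcongr

/-- Continuity up to 0 is inherited from `pInt`, which is differentiable on the whole line. -/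
theorem continuousOn_pc : ContinuousOn pc (Ici 0) :=
  ContinuousOn.congr (fun τ _ => (hasDerivAt_pInt τ).continuousAt.continuousWithinAt)
    fun _ h => pc_eq h

theorem continuousOn_pc1 : ContinuousOn pc1 (Ici 0) :=
  ContinuousOn.congr (fun τ _ => (hasDerivAt_pInt₁ τ).continuousAt.continuousWithinAt)
    fun _ h => pc1_eq h

theorem hasDerivAt_pc {τ : ℝ} (h : 0 < τ) : HasDerivAt pc (pc1 τ) τ := by
  rw [pc1_eq h.le]
  refine (hasDerivAt_pInt τ).congr_of_eventuallyEq ?_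
  filter_upwards [lt_mem_nhds h] with t ht using pc_eq ht.le

theorem hasDerivAt_pc1 {τ : ℝ} (h : 0 < τ) :
    HasDerivAt pc1 (-pc τ - Real.cosh τ / Real.sinh τ * pc1 τ) τ := by
  rw [pc1_eq h.le, pc_eq h.le, ← pInt₂_eq h]
  refine (hasDerivAt_pInt₁ τ).congr_of_eventuallyEq ?_
  filter_upwards [lt_mem_nhds h] with t ht using pc1_eq ht.le

theorem hasDerivAt_qc {τ : ℝ} (h : 0 < τ) : HasDerivAt qc (qc1 τ) τ := by
  rw [qc1_eq h]
  refine (hasDerivAt_qInt h).congr_of_eventuallyEq ?_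
  filter_upwards [lt_mem_nhds h] with t ht using qc_eq ht.le

theorem hasDerivAt_qc1 {τ : ℝ} (h : 0 < τ) :
    HasDerivAt qc1 (-qc τ - Real.cosh τ / Real.sinh τ * qc1 τ) τ := by
  rw [qc1_eq h, qc_eq h.le, ← qInt₂_eq h]
  refine (hasDerivAt_qInt₁ h).congr_of_eventuallyEq ?_
  filter_upwards [lt_mem_nhds h] with t ht using qc1_eq ht

/-! ### Singular behaviour of Q at the origin, and the Wronskian. -/

theorem half_rpow_mul {x : ℝ} (h : 0 < x) :
    (x / 2) ^ (-(1 / 2) : ℝ) * x = 2 * Real.sqrt (x / 2) := by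
  have h2 : 0 < x / 2 := by positivity
  have h3 : (x / 2) ^ (-(1 / 2) : ℝ) * Real.sqrt (x / 2) = 1 := by
    rw [Real.sqrt_eq_rpow, ← Real.rpow_add h2]; norm_num
  have h4 := Real.mul_self_sqrt h2.le
  calc _ = (x / 2) ^ (-(1 / 2) : ℝ) * (2 * (Real.sqrt (x / 2) * Real.sqrt (x / 2))) := by
        rw [h4]; ring
    _ = 2 * ((x / 2) ^ (-(1 / 2) : ℝ) * Real.sqrt (x / 2)) * Real.sqrt (x / 2) := by ring
    _ = _ := by rw [h3]; ring

theorem integral_exp_neg_half : ∫ s in Ioi (0 : ℝ), Real.exp (-(1 / 2) * s) = 2 := by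
  rw [integral_exp_mul_Ioi (by norm_num)]; norm_num

/-- The lower bound (sinh τ/2)e^s for the base gives Q = O((sinh τ)^{-1/2}). This is cruder than the
logarithmic singularity, but enough for Q sinh τ → 0. -/
theorem abs_qc_mul_sinh_le {τ : ℝ} (h : 0 < τ) :
    |qc τ * Real.sinh τ| ≤ 4 * Real.sqrt (Real.sinh τ / 2) := by
  have hs := Real.sinh_pos_iff.2 h
  have h1 : |qInt lapKernel τ| ≤ (Real.sinh τ / 2) ^ (-(1 / 2) : ℝ) * 2 := by
    refine (Complex.abs_re_le_norm _).trans ?_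
    have hI : (Real.sinh τ / 2) ^ (-(1 / 2) : ℝ) * 2 = ∫ s in Ioi (0 : ℝ),
        (Real.sinh τ / 2) ^ (-(1 / 2) : ℝ) * Real.exp (-(1 / 2) * s) := by
      rw [integral_const_mul, integral_exp_neg_half]
    rw [hI]
    refine norm_integral_le_of_norm_le (integrableOn_exp_neg_half.const_mul _) (ae_of_all _ ?_)
    intro s
    rw [norm_lapKernel _ (lapBase_cosh_pos h s), beta0_re]
    exact lapBase_cosh_rpow_le h le_rfl s
  rw [qc_eq h.le, abs_mul, abs_of_pos hs]
  calc _ ≤ (Real.sinh τ / 2) ^ (-(1 / 2) : ℝ) * 2 * Real.sinh τ := by gcongr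
    _ = 2 * ((Real.sinh τ / 2) ^ (-(1 / 2) : ℝ) * Real.sinh τ) := by ring
    _ = _ := by rw [half_rpow_mul hs]; ring

theorem tendsto_sinh_half_sqrt :
    Tendsto (fun τ => Real.sqrt (Real.sinh τ / 2)) (𝓝 0) (𝓝 0) := by
  have h : Continuous fun τ => Real.sqrt (Real.sinh τ / 2) := by fun_prop
  simpa using h.tendsto 0

theorem tendsto_qc_mul_sinh : Tendsto (fun τ => qc τ * Real.sinh τ) (𝓝[>] 0) (𝓝 0) := by
  refine squeeze_zero_norm' (a := fun τ => 4 * Real.sqrt (Real.sinh τ / 2)) ?_ ?_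
  · filter_upwards [self_mem_nhdsWithin] with τ hτ using abs_qc_mul_sinh_le hτ
  · simpa using (tendsto_sinh_half_sqrt.const_mul 4).mono_left nhdsWithin_le_nhds

theorem continuousOn_qc_mul_sinh : ContinuousOn (fun τ => qc τ * Real.sinh τ) (Ici 0) := by
  intro τ hτ
  rcases (mem_Ici.1 hτ).eq_or_lt with rfl | h
  · rw [← Ioi_insert, continuousWithinAt_insert_self]
    simpa [ContinuousWithinAt] using tendsto_qc_mul_sinh
  · exact ((hasDerivAt_qc h).continuousAt.mul Real.continuous_sinh.continuousAt).continuousWithinAt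

/-- The integrand sinh τ ∂_τ k is compared with ∂_s k, k being the kernel with c = cosh s. The
latter integrates exactly to minus the value of k at s = 0, that is, at c = 1. The difference
carries a factor O(sinh τ), which outweighs the (sinh τ)^{-1/2} from the kernel. Hence Q¹ sinh τ →
-1. -/
theorem norm_sinh_mul_integral_add_le {τ : ℝ} (h : 0 < τ) :
    ‖Real.sinh τ * (∫ s in Ioi (0 : ℝ), lapKernel₁ beta0 (Real.cosh s) τ) + lapKernel beta0 1 τ‖ ≤
      4 * ‖beta0‖ * Real.sqrt (Real.sinh τ / 2) * (2 * Real.sinh τ + 1) := by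
  have hs := Real.sinh_pos_iff.2 h
  have hp := lapBase_cosh_pos h
  have H := lapDominatedCosh h
  set D : ℝ → ℂ := fun s => beta0 * lapKernel beta0 (Real.cosh s) τ *
    ((Real.sinh τ * Real.sinh s / lapBase (Real.cosh s) τ : ℝ) : ℂ) with hD
  have hsc : ∀ s, |Real.sinh s| ≤ Real.cosh s := fun s => by
    rw [Real.abs_sinh, ← Real.cosh_abs]; exact (Real.sinh_lt_cosh _).le
  have hDle : ∀ s, ‖((Real.sinh τ * Real.sinh s / lapBase (Real.cosh s) τ : ℝ) : ℂ)‖ ≤ 1 := by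
    intro s
    rw [Complex.norm_real, Real.norm_eq_abs, abs_div, abs_of_pos (hp s), div_le_one (hp s), abs_mul,
      abs_of_pos hs, lapBase]
    nlinarith [hsc s, Real.cosh_pos τ]
  have hDcont : Continuous D := by
    refine (continuous_const.mul (continuous_lapKernel Real.continuous_cosh _ hp)).mul
      (Complex.continuous_ofReal.comp (Continuous.div ?_ ?_ fun s => (hp s).ne'))
    · fun_prop
    · unfold lapBase; fun_prop
  have hDint : IntegrableOn D (Ioi 0) := by
    refine (H.integrable_kernel.norm.const_mul ‖beta0‖).mono' hDcont.aestronglyMeasurable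
      (ae_of_all _ fun s => ?_)
    rw [hD, norm_mul, norm_mul]
    exact mul_le_of_le_one_right (by positivity) (hDle s)
  have hDval : ∫ s in Ioi (0 : ℝ), D s = -lapKernel beta0 1 τ := by
    rw [integral_Ioi_of_hasDerivAt_of_tendsto' (m := 0)
      (f := fun s => lapKernel beta0 (Real.cosh s) τ) ?_ hDint ?_]
    · simp
    · intro s _
      exact hasDerivAt_ofReal_cpow (f := fun s => lapBase (Real.cosh s) τ) beta0
        (((Real.hasDerivAt_cosh s).const_mul (Real.sinh τ)).const_add (Real.cosh τ)) (hp s)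
    · have hlim : Tendsto (fun x : ℝ => (Real.sinh τ / 2) ^ (-(1 / 2) : ℝ) *
          Real.exp (-(1 / 2) * x)) atTop (𝓝 0) := by
        have h1 : Tendsto (fun x : ℝ => Real.exp (-(1 / 2) * x)) atTop (𝓝 0) :=
          Real.tendsto_exp_atBot.comp
            (tendsto_id.const_mul_atTop_of_neg (by norm_num : (-(1 / 2) : ℝ) < 0))
        simpa using h1.const_mul ((Real.sinh τ / 2) ^ (-(1 / 2) : ℝ))
      refine squeeze_zero_norm (fun s => ?_) hlim
      rw [norm_lapKernel _ (hp s), beta0_re]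
      exact lapBase_cosh_rpow_le h le_rfl s
  have hsum : Real.sinh τ * (∫ s in Ioi (0 : ℝ), lapKernel₁ beta0 (Real.cosh s) τ)
      + lapKernel beta0 1 τ =
      ∫ s in Ioi (0 : ℝ), (Real.sinh τ * lapKernel₁ beta0 (Real.cosh s) τ - D s) := by
    rw [integral_sub (H.hasDerivAt_integral.1.const_mul _) hDint, integral_const_mul, hDval]
    ring
  rw [hsum]
  have hb : 4 * ‖beta0‖ * Real.sqrt (Real.sinh τ / 2) * (2 * Real.sinh τ + 1) =
      ∫ s in Ioi (0 : ℝ), ‖beta0‖ * (2 * Real.sinh τ ^ 2 + Real.sinh τ) *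
        ((Real.sinh τ / 2) ^ (-(1 / 2) : ℝ) * Real.exp (-(1 / 2) * s)) := by
    rw [integral_const_mul, integral_const_mul, integral_exp_neg_half]
    calc _ = ‖beta0‖ * (2 * Real.sinh τ + 1) * 2 * (2 * Real.sqrt (Real.sinh τ / 2)) := by ring
      _ = _ := by rw [← half_rpow_mul hs]; ring
  rw [hb]
  refine norm_integral_le_of_norm_le
    ((integrableOn_exp_neg_half.const_mul _).const_mul _) ((ae_restrict_iff' measurableSet_Ioi).2
      (ae_of_all _ fun s (hs0 : 0 < s) => ?_))
  -- Here cosh τ cosh s - sinh s is split as (cosh τ - 1) cosh s + e^{-s}; the first term is small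
  -- in τ relative to the base, the second is bounded.
  have hform : Real.sinh τ * lapKernel₁ beta0 (Real.cosh s) τ - D s =
      beta0 * lapKernel beta0 (Real.cosh s) τ * ((Real.sinh τ * (Real.sinh τ +
        (Real.cosh τ - 1) * Real.cosh s + Real.exp (-s)) / lapBase (Real.cosh s) τ : ℝ) : ℂ) := by
    rw [hD, lapKernel₁, ← Real.cosh_sub_sinh, lapBase']
    push_cast
    ring
  have hC1 : 1 ≤ Real.cosh τ := Real.one_le_cosh τ
  have hc1 : 1 ≤ Real.cosh s := Real.one_le_cosh s
  have hX : 1 ≤ lapBase (Real.cosh s) τ := by rw [lapBase]; nlinarith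
  have hX2 : Real.sinh τ * Real.cosh s ≤ lapBase (Real.cosh s) τ := by rw [lapBase]; linarith
  have he : Real.exp (-s) ≤ 1 := Real.exp_le_one_iff.2 (by linarith)
  have he0 := Real.exp_pos (-s)
  have hC2 : Real.cosh τ - 1 ≤ Real.sinh τ ^ 2 := by nlinarith [Real.cosh_sq τ]
  have hfac : ‖((Real.sinh τ * (Real.sinh τ + (Real.cosh τ - 1) * Real.cosh s + Real.exp (-s))
      / lapBase (Real.cosh s) τ : ℝ) : ℂ)‖ ≤ 2 * Real.sinh τ ^ 2 + Real.sinh τ := by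
    rw [Complex.norm_real, Real.norm_eq_abs, abs_div, abs_of_pos (hp s), div_le_iff₀ (hp s),
      abs_of_nonneg (by have : 0 ≤ Real.cosh τ - 1 := by linarith
                        positivity)]
    have e1 : Real.sinh τ * Real.sinh τ ≤ Real.sinh τ ^ 2 * lapBase (Real.cosh s) τ := by
      nlinarith [sq_nonneg (Real.sinh τ)]
    have e2 : (Real.cosh τ - 1) * (Real.sinh τ * Real.cosh s) ≤
        Real.sinh τ ^ 2 * lapBase (Real.cosh s) τ := by
      gcongr
    have e3 : Real.sinh τ * Real.exp (-s) ≤ Real.sinh τ * lapBase (Real.cosh s) τ := by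
      gcongr; linarith
    nlinarith
  rw [hform, norm_mul, norm_mul, norm_lapKernel _ (hp s), beta0_re]
  have hk := lapBase_cosh_rpow_le h le_rfl s
  have hk0 := Real.rpow_nonneg (hp s).le (-(1 / 2))
  calc _ ≤ ‖beta0‖ * ((Real.sinh τ / 2) ^ (-(1 / 2) : ℝ) * Real.exp (-(1 / 2) * s)) *
        (2 * Real.sinh τ ^ 2 + Real.sinh τ) := by gcongr
    _ = _ := by ring

theorem abs_qc1_mul_sinh_add_le {τ : ℝ} (h : 0 < τ) :
    |qc1 τ * Real.sinh τ + (lapKernel beta0 1 τ).re| ≤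
      4 * ‖beta0‖ * Real.sqrt (Real.sinh τ / 2) * (2 * Real.sinh τ + 1) := by
  refine le_trans ?_ (norm_sinh_mul_integral_add_le h)
  refine le_of_eq_of_le ?_ (Complex.abs_re_le_norm _)
  rw [qc1_eq h, qInt, Complex.add_re, Complex.re_ofReal_mul, mul_comm]

theorem lapBase_one (τ : ℝ) : lapBase 1 τ = Real.exp τ := by
  rw [lapBase, mul_one, Real.cosh_add_sinh]

theorem tendsto_qc1_mul_sinh : Tendsto (fun τ => qc1 τ * Real.sinh τ) (𝓝[>] 0) (𝓝 (-1)) := by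
  have h1 : Tendsto (fun τ => 4 * ‖beta0‖ * Real.sqrt (Real.sinh τ / 2) * (2 * Real.sinh τ + 1))
      (𝓝[>] 0) (𝓝 0) := by
    have : Continuous fun τ => 4 * ‖beta0‖ * Real.sqrt (Real.sinh τ / 2) * (2 * Real.sinh τ + 1) := by
      fun_prop
    have := this.tendsto 0
    simp only [Real.sinh_zero, zero_div, Real.sqrt_zero, mul_zero, zero_mul] at this
    exact this.mono_left nhdsWithin_le_nhds
  have h2 : Tendsto (fun τ => qc1 τ * Real.sinh τ + (lapKernel beta0 1 τ).re) (𝓝[>] 0) (𝓝 0) := by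
    refine squeeze_zero_norm' ?_ h1
    filter_upwards [self_mem_nhdsWithin] with τ hτ using abs_qc1_mul_sinh_add_le hτ
  have h3 : Tendsto (fun τ => (lapKernel beta0 1 τ).re) (𝓝[>] 0) (𝓝 1) := by
    have hd := (hasDerivAt_lapKernel beta0 (c := 1) (τ := 0)
      (by rw [lapBase_one]; exact Real.exp_pos _)).continuousAt
    have := (Complex.continuous_re.continuousAt.comp hd).tendsto
    simp only [Function.comp_def] at this
    rw [lapKernel, lapBase_one] at this
    simp only [Real.exp_zero, Complex.ofReal_one, Complex.one_cpow, Complex.one_re] at this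
    exact this.mono_left nhdsWithin_le_nhds
  simpa using h2.sub h3

theorem exists_core_bound (τ₀ : ℝ) : ∃ B : ℝ, 0 < B ∧ ∀ τ ∈ Icc 0 τ₀, |pc τ| ≤ B ∧ |pc1 τ| ≤ B ∧
    |qc τ * Real.sinh τ| ≤ B ∧ |qc1 τ * Real.sinh τ| ≤ B := by
  have hsub : Icc 0 τ₀ ⊆ Ici (0 : ℝ) := Icc_subset_Ici_self
  obtain ⟨B1, h1⟩ := isCompact_Icc.exists_bound_of_continuousOn (continuousOn_pc.mono hsub)
  obtain ⟨B2, h2⟩ := isCompact_Icc.exists_bound_of_continuousOn (continuousOn_pc1.mono hsub)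
  obtain ⟨B3, h3⟩ := isCompact_Icc.exists_bound_of_continuousOn
    (continuousOn_qc_mul_sinh.mono hsub)
  have hc : Continuous fun τ => 4 * ‖beta0‖ * Real.sqrt (Real.sinh τ / 2) * (2 * Real.sinh τ + 1) := by
    fun_prop
  obtain ⟨B4, h4⟩ := (isCompact_Icc (a := (0 : ℝ)) (b := τ₀)).exists_bound_of_continuousOn
    hc.continuousOn
  refine ⟨1 + |B1| + |B2| + |B3| + |B4|, by positivity, fun τ hτ => ?_⟩
  have e1 := le_abs_self B1
  have e2 := le_abs_self B2
  have e3 := le_abs_self B3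
  have e4 := le_abs_self B4
  have a1 := abs_nonneg B1
  have a2 := abs_nonneg B2
  have a3 := abs_nonneg B3
  have a4 := abs_nonneg B4
  have k1 := h1 τ hτ
  have k2 := h2 τ hτ
  have k3 := h3 τ hτ
  rw [Real.norm_eq_abs] at k1 k2 k3
  refine ⟨by linarith, by linarith, by linarith, ?_⟩
  rcases hτ.1.eq_or_lt with rfl | h
  · simp; positivity
  · have k4 := (le_abs_self _).trans (h4 τ hτ)
    have k5 := abs_qc1_mul_sinh_add_le h
    have k6 : |(lapKernel beta0 1 τ).re| ≤ 1 := by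
      refine (Complex.abs_re_le_norm _).trans ?_
      rw [norm_lapKernel _ (by rw [lapBase_one]; exact Real.exp_pos _), lapBase_one, beta0_re]
      exact Real.rpow_le_one_of_one_le_of_nonpos (Real.one_le_exp h.le) (by norm_num)
    have k7 := abs_sub_abs_le_abs_sub (qc1 τ * Real.sinh τ) (-(lapKernel beta0 1 τ).re)
    rw [abs_neg, sub_neg_eq_add] at k7
    linarith

/-- The factor sinh τ cancels the coth damping, so the left side is constant on τ > 0. Its value is
read off as τ → 0 from P → 1, P¹ → 0, Q sinh → 0 and Q¹ sinh → -1. -/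
theorem wronskian {τ : ℝ} (h : 0 < τ) :
    Real.sinh τ * (pc1 τ * qc τ - pc τ * qc1 τ) = 1 := by
  set W : ℝ → ℝ := fun t => Real.sinh t * (pc1 t * qc t - pc t * qc1 t) with hW
  have hd : ∀ t, 0 < t → HasDerivAt W 0 t := by
    intro t ht
    refine ((Real.hasDerivAt_sinh t).mul (((hasDerivAt_pc1 ht).mul (hasDerivAt_qc ht)).sub
      ((hasDerivAt_pc ht).mul (hasDerivAt_qc1 ht)))).congr_deriv ?_
    have hs := (Real.sinh_pos_iff.2 ht).ne'
    simp only [Pi.mul_apply, Pi.sub_apply]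
    field_simp
    ring
  have hconst : ∀ t, 0 < t → W t = W τ := by
    intro t ht
    exact isOpen_Ioi.is_const_of_deriv_eq_zero (convex_Ioi (0 : ℝ)).isPreconnected
      (fun x hx => (hd x hx).differentiableAt.differentiableWithinAt)
      (fun x hx => (hd x hx).deriv) ht h
  have hlim : Tendsto W (𝓝[>] 0) (𝓝 1) := by
    have hp : Tendsto pc (𝓝[>] 0) (𝓝 1) := by
      have := (continuousOn_pc 0 self_mem_Ici).tendsto
      rw [pc_eq le_rfl, pInt_zero] at this
      exact this.mono_left (nhdsWithin_mono _ Ioi_subset_Ici_self)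
    have hp1 : Tendsto pc1 (𝓝[>] 0) (𝓝 0) := by
      have := (continuousOn_pc1 0 self_mem_Ici).tendsto
      rw [pc1_eq le_rfl, pInt₁_zero] at this
      exact this.mono_left (nhdsWithin_mono _ Ioi_subset_Ici_self)
    have := (hp1.mul tendsto_qc_mul_sinh).sub (hp.mul tendsto_qc1_mul_sinh)
    simp only [zero_mul, one_mul, zero_sub, neg_neg] at this
    refine this.congr fun t => ?_
    simp only [hW]; ring
  refine tendsto_nhds_unique (Tendsto.congr' ?_ tendsto_const_nhds) hlim
  filter_upwards [self_mem_nhdsWithin] with t ht using (hconst t ht).symm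

/-! ### Decay of P and convergence of 𝓘. -/

/-- The decreasing energy controlling the decay of `P`. -/
def pEnergy (τ : ℝ) : ℝ :=
  Real.sinh τ * pc1 τ ^ 2 + Real.cosh τ * (pc1 τ * pc τ) + Real.sinh τ * pc τ ^ 2
    + pc τ ^ 2 / (2 * Real.sinh τ)

/-- The function y = √(sinh τ) P satisfies y'' + q y = 0 with q = 3/4 + 1/(4 sinh² τ). The energy is
y'² + q y², whose derivative is q' y² ≤ 0. -/
theorem hasDerivAt_pEnergy {τ : ℝ} (h : 0 < τ) :
    HasDerivAt pEnergy (-(Real.cosh τ * pc τ ^ 2 / (2 * Real.sinh τ ^ 2))) τ := by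
  have hs := (Real.sinh_pos_iff.2 h).ne'
  have hS := Real.hasDerivAt_sinh τ
  have hC := Real.hasDerivAt_cosh τ
  have hp := hasDerivAt_pc h
  have hp1 := hasDerivAt_pc1 h
  refine ((((hS.mul (hp1.pow 2)).add (hC.mul (hp1.mul hp))).add (hS.mul (hp.pow 2))).add
    ((hp.pow 2).div (hS.const_mul 2) (by positivity))).congr_deriv ?_
  simp only [Pi.mul_apply, Pi.pow_apply]
  field_simp
  have := Real.cosh_sq τ
  generalize Real.cosh τ = C at *
  generalize Real.sinh τ = S at *
  push_cast
  linear_combination (-2 * S * pc τ * pc1 τ) * this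

theorem sinh_mul_pc_sq_le {τ : ℝ} (h : 1 ≤ τ) :
    Real.sinh τ * pc τ ^ 2 ≤ 4 / 3 * pEnergy 1 := by
  have hanti : AntitoneOn pEnergy (Ioi 0) := by
    refine antitoneOn_of_deriv_nonpos (convex_Ioi 0)
      (fun x hx => (hasDerivAt_pEnergy hx).continuousAt.continuousWithinAt)
      (fun x hx => ?_) (fun x hx => ?_) <;> rw [interior_Ioi] at hx
    · exact (hasDerivAt_pEnergy hx).differentiableAt.differentiableWithinAt
    · rw [(hasDerivAt_pEnergy hx).deriv, neg_nonpos]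
      have := Real.cosh_pos x
      positivity
  have h0 : 0 < τ := by linarith
  have h1 := hanti (mem_Ioi.2 one_pos) (mem_Ioi.2 h0) h
  have hs := Real.sinh_pos_iff.2 h0
  -- The last square is y'² for y = √(sinh τ) P; the first two terms are q y².
  have h2 : pEnergy τ = 3 / 4 * (Real.sinh τ * pc τ ^ 2) + pc τ ^ 2 / (4 * Real.sinh τ)
      + Real.sinh τ * (pc1 τ + Real.cosh τ * pc τ / (2 * Real.sinh τ)) ^ 2 := by
    rw [pEnergy]
    field_simp
    have := Real.cosh_sq τ
    linear_combination (-4 * pc τ ^ 2) * this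
  have h3 : 0 ≤ pc τ ^ 2 / (4 * Real.sinh τ) := by positivity
  have h4 : 0 ≤ Real.sinh τ * (pc1 τ + Real.cosh τ * pc τ / (2 * Real.sinh τ)) ^ 2 := by positivity
  linarith

/-- Beyond s = 1 the factor P² sinh is bounded by the energy, and the remaining |P| is O(e^{-s/2}).
-/
theorem integrableOn_pc_cube : IntegrableOn (fun s : ℝ => pc s ^ 3 * Real.sinh s) (Ioi 0) := by
  have hcont : ContinuousOn (fun s : ℝ => pc s ^ 3 * Real.sinh s) (Ici 0) :=
    (continuousOn_pc.pow 3).mul Real.continuous_sinh.continuousOn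
  rw [← Ioc_union_Ioi_eq_Ioi (zero_le_one (α := ℝ)), integrableOn_union]
  constructor
  · exact ((hcont.mono Icc_subset_Ici_self).integrableOn_Icc).mono_set Ioc_subset_Icc_self
  · set M := 4 / 3 * pEnergy 1 with hM
    have hM0 : 0 ≤ M := le_trans (by have := Real.sinh_pos_iff.2 (one_pos (α := ℝ)); positivity)
      (sinh_mul_pc_sq_le le_rfl)
    have hint : IntegrableOn (fun s : ℝ => 2 * M * Real.sqrt M * Real.exp (-(1 / 2) * s)) (Ioi 1) :=
      (exp_neg_integrableOn_Ioi 1 (by norm_num)).const_mul _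
    refine hint.mono' ((hcont.mono (Ioi_subset_Ici zero_le_one)).aestronglyMeasurable
      measurableSet_Ioi) ((ae_restrict_iff' measurableSet_Ioi).2 (ae_of_all _ fun s hs => ?_))
    have hs1 : 1 ≤ s := le_of_lt hs
    have hb := sinh_mul_pc_sq_le hs1
    rw [← hM] at hb
    have hsh : Real.exp s / 4 ≤ Real.sinh s := by
      have h1 : Real.exp (-s) ≤ 1 / 2 := by
        have e1 := Real.add_one_le_exp s
        have e2 : Real.exp (-s) * Real.exp s = 1 := by rw [← Real.exp_add]; simp
        nlinarith [Real.exp_pos (-s)]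
      have h2 := Real.add_one_le_exp s
      rw [Real.sinh_eq]; linarith
    have hsp : 0 < Real.sinh s := lt_of_lt_of_le (by positivity) hsh
    have hexp : Real.exp (-(1 / 2) * s) ^ 2 * Real.exp s = 1 := by
      rw [← Real.exp_nat_mul, ← Real.exp_add]; simp
    have hP : |pc s| ≤ 2 * Real.sqrt M * Real.exp (-(1 / 2) * s) := by
      refine abs_le_of_sq_le_sq ?_ (by positivity)
      rw [mul_pow, mul_pow, Real.sq_sqrt hM0]
      have h1 : Real.exp s * pc s ^ 2 ≤ 4 * M := by nlinarith [sq_nonneg (pc s)]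
      have h2 := mul_le_mul_of_nonneg_left h1 (sq_nonneg (Real.exp (-(1 / 2) * s)))
      calc pc s ^ 2 = Real.exp (-(1 / 2) * s) ^ 2 * Real.exp s * pc s ^ 2 := by rw [hexp, one_mul]
        _ ≤ _ := by linarith
    rw [Real.norm_eq_abs, abs_mul, abs_pow, abs_of_pos hsp]
    calc |pc s| ^ 3 * Real.sinh s = |pc s| * (Real.sinh s * pc s ^ 2) := by
          rw [← sq_abs (pc s)]; ring
      _ ≤ 2 * Real.sqrt M * Real.exp (-(1 / 2) * s) * M := by gcongr
      _ = _ := by ring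

theorem tendsto_integral_pc_cube :
    Tendsto (fun τ => (∫ s in (0 : ℝ)..τ, pc s ^ 3 * Real.sinh s) - calI) atTop (𝓝 0) := by
  have := (intervalIntegral_tendsto_integral_Ioi 0 integrableOn_pc_cube tendsto_id).sub_const calI
  simpa [calI] using this

/-! ### Smooth families of small solutions of a cubic fixed-point equation. -/

section CubicFixedPoint

variable {X Y D : Type*} [NormedCommRing X] [NormedAlgebra ℝ X]
  [NormedAddCommGroup Y] [NormedSpace ℝ Y] [CompleteSpace Y]
  [NormedAddCommGroup D] [NormedSpace ℝ D] [CompleteSpace D]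

/-- The nonlinearity `λ u + ν u² - η u³`. -/
def cubic (ν η lam : ℝ) (u : X) : X := lam • u + ν • u ^ 2 - η • u ^ 3

/-- A general normed commutative ring serves both C[0, τ₀], for the contraction, and ℝ, for the
pointwise Grönwall estimate. -/
theorem norm_cubic_sub_le (ν η lam : ℝ) {s : ℝ} {u v : X} (hu : ‖u‖ ≤ s) (hv : ‖v‖ ≤ s) :
    ‖cubic ν η lam u - cubic ν η lam v‖ ≤ (|lam| + 2 * |ν| * s + 3 * |η| * s ^ 2) * ‖u - v‖ := by
  have hs : 0 ≤ s := (norm_nonneg u).trans hu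
  have h : cubic ν η lam u - cubic ν η lam v = lam • (u - v) + ν • ((u + v) * (u - v))
      - η • ((u * u + u * v + v * v) * (u - v)) := by
    simp only [cubic, Algebra.smul_def]; ring
  have h1 : ‖(u + v) * (u - v)‖ ≤ (2 * s) * ‖u - v‖ :=
    (norm_mul_le _ _).trans (by gcongr; linarith [norm_add_le u v])
  have h2 : ‖u * u + u * v + v * v‖ ≤ 3 * s ^ 2 := by
    have e1 := (norm_mul_le u u).trans (mul_le_mul hu hu (norm_nonneg _) hs)
    have e2 := (norm_mul_le u v).trans (mul_le_mul hu hv (norm_nonneg _) hs)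
    have e3 := (norm_mul_le v v).trans (mul_le_mul hv hv (norm_nonneg _) hs)
    have e4 := norm_add_le (u * u + u * v) (v * v)
    have e5 := norm_add_le (u * u) (u * v)
    nlinarith
  have h3 : ‖(u * u + u * v + v * v) * (u - v)‖ ≤ (3 * s ^ 2) * ‖u - v‖ :=
    (norm_mul_le _ _).trans (by gcongr)
  rw [h]
  calc _ ≤ ‖lam • (u - v)‖ + ‖ν • ((u + v) * (u - v))‖
        + ‖η • ((u * u + u * v + v * v) * (u - v))‖ :=
        (norm_sub_le _ _).trans (by gcongr; exact norm_add_le _ _)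
    _ ≤ |lam| * ‖u - v‖ + |ν| * ((2 * s) * ‖u - v‖) + |η| * ((3 * s ^ 2) * ‖u - v‖) := by
        rw [norm_smul, norm_smul, norm_smul, Real.norm_eq_abs, Real.norm_eq_abs, Real.norm_eq_abs]
        gcongr
    _ = _ := by ring

@[simp] theorem cubic_zero (ν η lam : ℝ) : cubic ν η lam (0 : X) = 0 := by simp [cubic]

/-- Solutions of `U = T d + K (λ u + ν u² - η u³)`, `u = p U`, near `0` form a smooth family. -/
theorem exists_cubic_fixedPoint (ν η : ℝ) (p : Y →L[ℝ] X) (K : X →L[ℝ] Y) (T : D →L[ℝ] Y) :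
    ∃ (R r : ℝ) (Φ : D × ℝ → Y), 0 < R ∧ 0 < r ∧
      ContDiffOn ℝ ∞ Φ (Metric.ball 0 r ×ˢ Ioo (-r) r) ∧
      ∀ (d : D) (lam : ℝ), ‖d‖ < r → |lam| < r →
        Φ (d, lam) = T d + K (cubic ν η lam (p (Φ (d, lam)))) ∧
        ‖Φ (d, lam)‖ ≤ 2 * ‖T‖ * ‖d‖ ∧
        ∀ U : Y, ‖U‖ < R → U = T d + K (cubic ν η lam (p U)) → U = Φ (d, lam) := by
  -- R bounds both |λ| and ‖U‖. The Lipschitz constant 1/2 yields the bound 2‖T‖‖d‖ as well as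
  -- uniqueness.
  obtain ⟨R, hR0, hR⟩ : ∃ R : ℝ, 0 < R ∧ ‖K‖ * ((R + 2 * |ν| * (‖p‖ * R)
      + 3 * |η| * (‖p‖ * R) ^ 2) * ‖p‖) ≤ 1 / 2 := by
    have hc : Continuous fun R : ℝ => ‖K‖ * ((R + 2 * |ν| * (‖p‖ * R)
      + 3 * |η| * (‖p‖ * R) ^ 2) * ‖p‖) := by fun_prop
    have ht := hc.tendsto 0
    simp only [mul_zero, zero_pow (two_ne_zero), add_zero, zero_mul] at ht
    have := (ht.mono_left nhdsWithin_le_nhds : Tendsto _ (𝓝[>] (0 : ℝ)) _).eventually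
      (ge_mem_nhds (by norm_num : (0 : ℝ) < 1 / 2))
    obtain ⟨R, h1, h2⟩ := (this.and self_mem_nhdsWithin).exists
    exact ⟨R, h2, h1⟩
  have hlip : ∀ (lam : ℝ) (U V : Y), |lam| ≤ R → ‖U‖ ≤ R → ‖V‖ ≤ R →
      ‖K (cubic ν η lam (p U)) - K (cubic ν η lam (p V))‖ ≤ 1 / 2 * ‖U - V‖ := by
    intro lam U V hl hU hV
    have hpU : ‖p U‖ ≤ ‖p‖ * R := p.le_of_opNorm_le_of_le le_rfl hU
    have hpV : ‖p V‖ ≤ ‖p‖ * R := p.le_of_opNorm_le_of_le le_rfl hV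
    have h1 := norm_cubic_sub_le ν η lam hpU hpV
    have h2 : ‖p U - p V‖ ≤ ‖p‖ * ‖U - V‖ := by rw [← map_sub]; exact p.le_opNorm _
    rw [← map_sub]
    calc _ ≤ ‖K‖ * ‖cubic ν η lam (p U) - cubic ν η lam (p V)‖ := K.le_opNorm _
      _ ≤ ‖K‖ * ((R + 2 * |ν| * (‖p‖ * R) + 3 * |η| * (‖p‖ * R) ^ 2) * (‖p‖ * ‖U - V‖)) := by
        gcongr
        refine h1.trans ?_
        gcongr
      _ = ‖K‖ * ((R + 2 * |ν| * (‖p‖ * R) + 3 * |η| * (‖p‖ * R) ^ 2) * ‖p‖) * ‖U - V‖ := by ring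
      _ ≤ _ := by gcongr
  set m : Y × (D × ℝ) →L[ℝ] X := p.comp (ContinuousLinearMap.fst ℝ Y (D × ℝ) +
    (T.comp (ContinuousLinearMap.fst ℝ D ℝ)).comp (ContinuousLinearMap.snd ℝ Y (D × ℝ))) with hm
  set l : Y × (D × ℝ) →L[ℝ] ℝ :=
    (ContinuousLinearMap.snd ℝ D ℝ).comp (ContinuousLinearMap.snd ℝ Y (D × ℝ)) with hl
  set N : Y × (D × ℝ) → X := fun z => cubic ν η (l z) (m z) with hN
  -- The unknown is V = U - T d, with the parameters carried along. As N has no linear part (λu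
  -- counts as quadratic), the derivative of Ψ at 0 is the identity, and the solutions sought are
  -- the preimages of (0, (d, λ)).
  set Ψ : Y × (D × ℝ) → Y × (D × ℝ) := fun z => (z.1 - K (N z), z.2) with hΨ
  -- Analyticity is used because, unlike C^∞ at a point, it propagates from 0 to a whole
  -- neighbourhood for the inverse map.
  have hNs : ContDiff ℝ ω N :=
    ((l.contDiff.smul m.contDiff).add ((m.contDiff.pow 2).const_smul ν)).sub
      ((m.contDiff.pow 3).const_smul η)
  have hΨs : ContDiff ℝ ω Ψ :=
    (contDiff_fst.sub (K.contDiff.comp hNs)).prodMk contDiff_snd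
  have hNd : HasFDerivAt N (0 : Y × (D × ℝ) →L[ℝ] X) 0 := by
    have h := ((l.hasFDerivAt.smul m.hasFDerivAt).add
      (((m.hasFDerivAt (x := 0)).pow 2).const_smul ν)).sub
      (((m.hasFDerivAt (x := 0)).pow 3).const_smul η)
    refine h.congr_fderiv ?_
    ext z <;> simp
  have hΨd : HasFDerivAt Ψ
      ((ContinuousLinearEquiv.refl ℝ (Y × (D × ℝ)) : (Y × (D × ℝ)) ≃L[ℝ] (Y × (D × ℝ))) :
        (Y × (D × ℝ)) →L[ℝ] (Y × (D × ℝ))) 0 := by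
    have h := (hasFDerivAt_fst (𝕜 := ℝ) (E := Y) (F := D × ℝ) (p := 0)).sub
      (K.hasFDerivAt.comp (0 : Y × (D × ℝ)) hNd)
    refine (h.prodMk hasFDerivAt_snd).congr_fderiv ?_
    ext z <;> simp
  have hΨ0 : Ψ 0 = 0 := by simp [hΨ, hN]
  set e := hΨs.contDiffAt.toOpenPartialHomeomorph Ψ hΨd (by simp) with he
  have hecoe : ∀ z, e z = Ψ z := fun z => rfl
  have h0s : (0 : Y × (D × ℝ)) ∈ e.source :=
    hΨs.contDiffAt.mem_toOpenPartialHomeomorph_source hΨd (by simp)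
  have h0t : (0 : Y × (D × ℝ)) ∈ e.target := by
    have := e.map_source h0s
    rwa [hecoe, hΨ0] at this
  have hsymm0 : e.symm 0 = 0 := by
    have := e.left_inv h0s
    rwa [hecoe, hΨ0] at this
  have hsd : ContDiffAt ℝ ω e.symm 0 := by
    refine e.contDiffAt_symm h0t (f₀' := ContinuousLinearEquiv.refl ℝ (Y × (D × ℝ))) ?_ ?_
    · rw [hsymm0]; exact hΨd
    · rw [hsymm0]; exact hΨs.contDiffAt
  set Φ : D × ℝ → Y := fun q => (e.symm (0, q)).1 + T q.1 with hΦ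
  have hev : ∀ᶠ y in 𝓝 (0 : Y × (D × ℝ)), y ∈ e.target ∧ ContDiffAt ℝ ω e.symm y ∧
      ‖(e.symm y).1 + T y.2.1‖ < R := by
    refine (e.open_target.eventually_mem h0t).and ((hsd.eventually (by simp)).and ?_)
    have hc : ContinuousAt (fun y => ‖(e.symm y).1 + T y.2.1‖) (0 : Y × (D × ℝ)) :=
      ((continuous_fst.continuousAt.comp hsd.continuousAt).add (by fun_prop)).norm
    refine hc.eventually_lt_const ?_
    simpa [hsymm0] using hR0
  have hev2 : ∀ᶠ q in 𝓝 (0 : D × ℝ), ((0 : Y), q) ∈ e.target ∧ ContDiffAt ℝ ω e.symm ((0 : Y), q) ∧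
      ‖Φ q‖ < R := by
    have hc : ContinuousAt (fun q : D × ℝ => ((0 : Y), q)) 0 := by fun_prop
    exact hc.eventually hev
  obtain ⟨r', hr'0, hr'⟩ := Metric.eventually_nhds_iff.1 hev2
  set r := min r' R with hr
  have hmem : ∀ (d : D) (lam : ℝ), ‖d‖ < r → |lam| < r → ((0 : Y), (d, lam)) ∈ e.target ∧
      ContDiffAt ℝ ω e.symm ((0 : Y), (d, lam)) ∧ ‖Φ (d, lam)‖ < R := by
    intro d lam hd hlam
    refine hr' ?_
    rw [dist_zero_right, Prod.norm_def, max_lt_iff, Real.norm_eq_abs]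
    exact ⟨hd.trans_le (min_le_left _ _), hlam.trans_le (min_le_left _ _)⟩
  refine ⟨R, r, Φ, hR0, lt_min hr'0 hR0, ?_, fun d lam hd hlam => ?_⟩
  · rintro ⟨d, lam⟩ ⟨hd, hlam⟩
    have h := (hmem d lam (by simpa using hd) (abs_lt.2 hlam)).2.1
    have h2 : ContDiffAt ℝ ω Φ (d, lam) :=
      (contDiffAt_fst.comp (d, lam) (h.comp (d, lam)
        (contDiffAt_const.prodMk contDiffAt_id))).add
        (T.contDiff.contDiffAt.comp (d, lam) contDiffAt_fst)
    exact (h2.of_le le_top).contDiffWithinAt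
  · obtain ⟨ht, -, hb⟩ := hmem d lam hd hlam
    have hlR : |lam| ≤ R := hlam.le.trans (min_le_right _ _)
    have hinv : Ψ (e.symm ((0 : Y), (d, lam))) = ((0 : Y), (d, lam)) := e.right_inv ht
    have h2 : (e.symm ((0 : Y), (d, lam))).2 = (d, lam) := congrArg Prod.snd hinv
    have h1 : (e.symm ((0 : Y), (d, lam))).1 - K (N (e.symm ((0 : Y), (d, lam)))) = 0 :=
      congrArg Prod.fst hinv
    have hNval : N (e.symm ((0 : Y), (d, lam))) = cubic ν η lam (p (Φ (d, lam))) := by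
      simp [hN, hl, hm, hΦ, h2]
    have hfix : Φ (d, lam) = T d + K (cubic ν η lam (p (Φ (d, lam)))) := by
      rw [hNval, sub_eq_zero] at h1
      rw [add_comm, ← h1]
    refine ⟨hfix, ?_, fun U hU hUeq => ?_⟩
    · have h3 := hlip lam (Φ (d, lam)) 0 hlR hb.le (by simpa using hR0.le)
      simp only [map_zero, cubic_zero, sub_zero] at h3
      have h4 : ‖Φ (d, lam)‖ ≤ ‖T d‖ + ‖K (cubic ν η lam (p (Φ (d, lam))))‖ :=
        (congrArg norm hfix).le.trans (norm_add_le _ _)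
      have h5 := T.le_opNorm d
      linarith
    · have h3 := hlip lam U (Φ (d, lam)) hlR hU.le hb.le
      have h4 : U - Φ (d, lam) = K (cubic ν η lam (p U)) - K (cubic ν η lam (p (Φ (d, lam)))) := by
        nth_rw 1 [hUeq, hfix]; abel
      rw [← h4] at h3
      have h5 : ‖U - Φ (d, lam)‖ ≤ 0 := by linarith
      exact sub_eq_zero.1 (norm_le_zero_iff.1 h5)

end CubicFixedPoint

/-! ### The scalar equation u'' + coth τ u' + u = F. -/

theorem hasDerivAt_integral_of_continuousOn_Ici {f : ℝ → ℝ} (hf : ContinuousOn f (Ici 0)) {τ : ℝ}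
    (h : 0 < τ) : HasDerivAt (fun t => ∫ s in (0 : ℝ)..t, f s) (f τ) τ := by
  set g : ℝ → ℝ := fun s => f (max s 0) with hg
  have hgc : Continuous g := hf.comp_continuous (by fun_prop) fun s => le_max_right s 0
  have h1 := (hgc.integral_hasStrictDerivAt 0 τ).hasDerivAt
  have h2 : g τ = f τ := by simp [hg, h.le]
  rw [h2] at h1
  refine h1.congr_of_eventuallyEq ?_
  filter_upwards [lt_mem_nhds h] with t ht
  refine intervalIntegral.integral_congr fun s hs => ?_
  rw [uIcc_of_le (le_of_lt ht)] at hs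
  simp [hg, hs.1]

theorem intervalIntegrable_of_continuousOn_Ici {f : ℝ → ℝ} (hf : ContinuousOn f (Ici 0)) {τ : ℝ}
    (h : 0 ≤ τ) : IntervalIntegrable f volume 0 τ :=
  (hf.mono (by rw [uIcc_of_le h]; exact Icc_subset_Ici_self)).intervalIntegrable

/-- `∫₀^τ P F sinh`. -/
def momP (F : ℝ → ℝ) (τ : ℝ) : ℝ := ∫ s in (0 : ℝ)..τ, pc s * F s * Real.sinh s

/-- `∫₀^τ Q F sinh`. -/
def momQ (F : ℝ → ℝ) (τ : ℝ) : ℝ := ∫ s in (0 : ℝ)..τ, qc s * F s * Real.sinh s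

/-- The solution of `u'' + coth u' + u = F` that is regular and vanishes at `0`. -/
def greenFun (F : ℝ → ℝ) (τ : ℝ) : ℝ := pc τ * momQ F τ - qc τ * momP F τ

/-- The derivative of `greenFun F`. -/
def greenFun' (F : ℝ → ℝ) (τ : ℝ) : ℝ := pc1 τ * momQ F τ - qc1 τ * momP F τ

section

variable {F : ℝ → ℝ}

theorem continuousOn_momP_integrand (hF : ContinuousOn F (Ici 0)) :
    ContinuousOn (fun s => pc s * F s * Real.sinh s) (Ici 0) :=
  (continuousOn_pc.mul hF).mul Real.continuous_sinh.continuousOn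

theorem continuousOn_momQ_integrand (hF : ContinuousOn F (Ici 0)) :
    ContinuousOn (fun s => qc s * F s * Real.sinh s) (Ici 0) :=
  (continuousOn_qc_mul_sinh.mul hF).congr fun s _ => by simp only [Pi.mul_apply]; ring

theorem hasDerivAt_greenFun (hF : ContinuousOn F (Ici 0)) {τ : ℝ} (h : 0 < τ) :
    HasDerivAt (greenFun F) (greenFun' F τ) τ := by
  have hP := hasDerivAt_integral_of_continuousOn_Ici (continuousOn_momP_integrand hF) h
  have hQ := hasDerivAt_integral_of_continuousOn_Ici (continuousOn_momQ_integrand hF) h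
  refine (((hasDerivAt_pc h).mul hQ).sub ((hasDerivAt_qc h).mul hP)).congr_deriv ?_
  simp only [greenFun', momP, momQ]
  ring

theorem hasDerivAt_greenFun' (hF : ContinuousOn F (Ici 0)) {τ : ℝ} (h : 0 < τ) :
    HasDerivAt (greenFun' F)
      (F τ - greenFun F τ - Real.cosh τ / Real.sinh τ * greenFun' F τ) τ := by
  have hP := hasDerivAt_integral_of_continuousOn_Ici (continuousOn_momP_integrand hF) h
  have hQ := hasDerivAt_integral_of_continuousOn_Ici (continuousOn_momQ_integrand hF) h
  refine (((hasDerivAt_pc1 h).mul hQ).sub ((hasDerivAt_qc1 h).mul hP)).congr_deriv ?_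
  simp only [greenFun, greenFun', momP, momQ]
  linear_combination F τ * wronskian h

/-- The singular factors Q and Q¹ multiply `momP`, which by monotonicity of sinh is at most B m τ
sinh τ; this sinh τ absorbs the singularity. The surviving factor τ gives continuity at 0. -/
theorem abs_green_le {τ₀ B m : ℝ}
    (hB : ∀ τ ∈ Icc 0 τ₀, |pc τ| ≤ B ∧ |pc1 τ| ≤ B ∧
      |qc τ * Real.sinh τ| ≤ B ∧ |qc1 τ * Real.sinh τ| ≤ B)
    (hm : ∀ τ ∈ Icc 0 τ₀, |F τ| ≤ m) {τ : ℝ} (hτ : τ ∈ Icc 0 τ₀) :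
    |greenFun F τ| ≤ 2 * B ^ 2 * m * τ ∧ |greenFun' F τ| ≤ 2 * B ^ 2 * m * τ := by
  have hB0 : 0 ≤ B := (abs_nonneg _).trans (hB τ hτ).1
  have hm0 : 0 ≤ m := (abs_nonneg _).trans (hm τ hτ)
  have hs0 : 0 ≤ Real.sinh τ := Real.sinh_nonneg_iff.2 hτ.1
  have hmem : ∀ s ∈ uIoc (0 : ℝ) τ, s ∈ Icc 0 τ₀ ∧ s ≤ τ := by
    intro s hs
    rw [uIoc_of_le hτ.1] at hs
    exact ⟨⟨hs.1.le, hs.2.trans hτ.2⟩, hs.2⟩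
  have hP : |momP F τ| ≤ B * m * Real.sinh τ * τ := by
    have := intervalIntegral.norm_integral_le_of_norm_le_const (a := 0) (b := τ)
      (f := fun s => pc s * F s * Real.sinh s) (C := B * m * Real.sinh τ) fun s hs => by
        obtain ⟨h1, h2⟩ := hmem s hs
        rw [Real.norm_eq_abs, abs_mul, abs_mul, abs_of_nonneg (Real.sinh_nonneg_iff.2 h1.1)]
        have := Real.sinh_le_sinh.2 h2
        have := Real.sinh_nonneg_iff.2 h1.1
        gcongr
        · exact (hB s h1).1
        · exact hm s h1
    rwa [sub_zero, abs_of_nonneg hτ.1] at this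
  have hQ : |momQ F τ| ≤ B * m * τ := by
    have := intervalIntegral.norm_integral_le_of_norm_le_const (a := 0) (b := τ)
      (f := fun s => qc s * F s * Real.sinh s) (C := B * m) fun s hs => by
        obtain ⟨h1, h2⟩ := hmem s hs
        rw [mul_right_comm, Real.norm_eq_abs, abs_mul]
        gcongr
        · exact (hB s h1).2.2.1
        · exact hm s h1
    rwa [sub_zero, abs_of_nonneg hτ.1] at this
  obtain ⟨b1, b2, b3, b4⟩ := hB τ hτ
  rw [abs_mul, abs_of_nonneg hs0] at b3 b4
  have hτ0 := hτ.1
  have main : ∀ x y : ℝ, |x| ≤ B → |y| * Real.sinh τ ≤ B →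
      |x * momQ F τ - y * momP F τ| ≤ 2 * B ^ 2 * m * τ := by
    intro x y hx hy
    calc _ ≤ |x| * |momQ F τ| + |y| * |momP F τ| := by
          rw [← abs_mul, ← abs_mul]; exact abs_sub _ _
      _ ≤ B * (B * m * τ) + |y| * (B * m * Real.sinh τ * τ) := by gcongr
      _ = B * (B * m * τ) + |y| * Real.sinh τ * (B * m * τ) := by ring
      _ ≤ B * (B * m * τ) + B * (B * m * τ) := by gcongr
      _ = _ := by ring
  exact ⟨main _ _ b1 b3, main _ _ b2 b4⟩

/-- Both moments vanish at 0, so the values assigned there to `qc` and `qc1` are irrelevant. -/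
theorem green_zero : greenFun F 0 = 0 ∧ greenFun' F 0 = 0 := by
  simp [greenFun, greenFun', momP, momQ]

theorem continuousOn_green (hF : ContinuousOn F (Ici 0)) (τ₀ : ℝ) :
    ContinuousOn (greenFun F) (Icc 0 τ₀) ∧ ContinuousOn (greenFun' F) (Icc 0 τ₀) := by
  obtain ⟨B, -, hB⟩ := exists_core_bound τ₀
  obtain ⟨m, hm⟩ := (isCompact_Icc (a := (0 : ℝ)) (b := τ₀)).exists_bound_of_continuousOn
    (hF.mono Icc_subset_Ici_self)
  have hlim : Tendsto (fun τ : ℝ => 2 * B ^ 2 * m * τ) (𝓝[Icc 0 τ₀] 0) (𝓝 0) := by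
    have : Continuous fun τ : ℝ => 2 * B ^ 2 * m * τ := by fun_prop
    simpa using (this.tendsto 0).mono_left (nhdsWithin_le_nhds (s := Icc 0 τ₀))
  constructor <;> intro τ hτ <;> rcases hτ.1.eq_or_lt with rfl | h
  · rw [ContinuousWithinAt, green_zero.1]
    refine squeeze_zero_norm' ?_ hlim
    filter_upwards [self_mem_nhdsWithin] with t ht using (abs_green_le hB hm ht).1
  · exact (hasDerivAt_greenFun hF h).continuousAt.continuousWithinAt
  · rw [ContinuousWithinAt, green_zero.2]
    refine squeeze_zero_norm' ?_ hlim
    filter_upwards [self_mem_nhdsWithin] with t ht using (abs_green_le hB hm ht).2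
  · exact (hasDerivAt_greenFun' hF h).continuousAt.continuousWithinAt

end

theorem eq_of_hasDerivWithinAt_zero_Ioc {f : ℝ → ℝ} {b : ℝ}
    (hf : ∀ x ∈ Ioc 0 b, HasDerivWithinAt f 0 (Icc 0 b) x) {x y : ℝ} (hx : x ∈ Ioc 0 b)
    (hy : y ∈ Ioc 0 b) : f y = f x := by
  have := (convex_Ioc (0 : ℝ) b).norm_image_sub_le_of_norm_hasDerivWithin_le (C := 0)
    (fun z hz => (hf z hz).mono Ioc_subset_Icc_self) (fun z _ => by simp) hx hy
  rw [zero_mul] at this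
  exact sub_eq_zero.1 (norm_le_zero_iff.1 this)

theorem eqOn_Icc_of_eqOn_Ioc {f g : ℝ → ℝ} {b : ℝ} (hb : 0 < b) (hf : ContinuousOn f (Icc 0 b))
    (hg : ContinuousOn g (Icc 0 b)) (h : EqOn f g (Ioc 0 b)) : EqOn f g (Icc 0 b) :=
  h.of_subset_closure hf hg Ioc_subset_Icc_self (by rw [closure_Ioc hb.ne])

/-- Bounded solutions of the homogeneous scalar equation are multiples of `P`. -/
theorem exists_eq_mul_pc {y v : ℝ → ℝ} {b : ℝ} (hb : 0 < b) (hy : ContinuousOn y (Icc 0 b))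
    (hv : ContinuousOn v (Icc 0 b))
    (hy' : ∀ τ ∈ Ioc 0 b, HasDerivWithinAt y (v τ) (Icc 0 b) τ)
    (hv' : ∀ τ ∈ Ioc 0 b, HasDerivWithinAt v
      (-y τ - Real.cosh τ / Real.sinh τ * v τ) (Icc 0 b) τ) :
    ∃ x : ℝ, ∀ τ ∈ Icc 0 b, y τ = x * pc τ ∧ v τ = x * pc1 τ := by
  have hpc := continuousOn_pc.mono (Icc_subset_Ici_self (a := b) (b := 0))
  have hpc1 := continuousOn_pc1.mono (Icc_subset_Ici_self (a := b) (b := 0))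
  have hbb : b ∈ Ioc 0 b := ⟨hb, le_rfl⟩
  -- The weighted Wronskians with P and Q are both constant. The one with P is continuous up to 0
  -- and vanishes there, which removes the Q component; the one with Q is the coefficient of P.
  set w : ℝ → ℝ := fun t => Real.sinh t * (pc t * v t - pc1 t * y t) with hw
  set z : ℝ → ℝ := fun t => Real.sinh t * (qc t * v t - qc1 t * y t) with hz
  have hw' : ∀ τ ∈ Ioc 0 b, HasDerivWithinAt w 0 (Icc 0 b) τ := by
    intro τ hτ
    have hs := (Real.sinh_pos_iff.2 hτ.1).ne'
    refine ((Real.hasDerivAt_sinh τ).hasDerivWithinAt.mul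
      (((hasDerivAt_pc hτ.1).hasDerivWithinAt.mul (hv' τ hτ)).sub
      ((hasDerivAt_pc1 hτ.1).hasDerivWithinAt.mul (hy' τ hτ)))).congr_deriv ?_
    simp only [Pi.mul_apply, Pi.sub_apply]
    field_simp
    ring
  have hz' : ∀ τ ∈ Ioc 0 b, HasDerivWithinAt z 0 (Icc 0 b) τ := by
    intro τ hτ
    have hs := (Real.sinh_pos_iff.2 hτ.1).ne'
    refine ((Real.hasDerivAt_sinh τ).hasDerivWithinAt.mul
      (((hasDerivAt_qc hτ.1).hasDerivWithinAt.mul (hv' τ hτ)).sub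
      ((hasDerivAt_qc1 hτ.1).hasDerivWithinAt.mul (hy' τ hτ)))).congr_deriv ?_
    simp only [Pi.mul_apply, Pi.sub_apply]
    field_simp
    ring
  have hw0 : ∀ τ ∈ Ioc 0 b, w τ = 0 := by
    have hwc : ContinuousOn w (Icc 0 b) :=
      Real.continuous_sinh.continuousOn.mul ((hpc.mul hv).sub (hpc1.mul hy))
    have h1 : EqOn w (fun _ => w b) (Icc 0 b) :=
      eqOn_Icc_of_eqOn_Ioc hb hwc continuousOn_const fun τ hτ =>
        eq_of_hasDerivWithinAt_zero_Ioc hw' hbb hτ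
    have h2 : w 0 = 0 := by simp [hw]
    intro τ hτ
    rw [h1 (Ioc_subset_Icc_self hτ), ← h2]
    exact (h1 ⟨le_rfl, hb.le⟩).symm
  have key : ∀ τ ∈ Ioc 0 b, y τ = z b * pc τ ∧ v τ = z b * pc1 τ := by
    intro τ hτ
    have e0 := hw0 τ hτ
    have e1 : z τ = z b := eq_of_hasDerivWithinAt_zero_Ioc hz' hbb hτ
    have e2 := wronskian hτ.1
    simp only [hw] at e0
    rw [← e1]
    simp only [hz]
    constructor
    · linear_combination (-y τ) * e2 - qc τ * e0
    · linear_combination (-v τ) * e2 - qc1 τ * e0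
  refine ⟨z b, fun τ hτ => ⟨?_, ?_⟩⟩
  · exact eqOn_Icc_of_eqOn_Ioc hb hy (continuousOn_const.mul hpc) (fun t ht => (key t ht).1) hτ
  · exact eqOn_Icc_of_eqOn_Ioc hb hv (continuousOn_const.mul hpc1) (fun t ht => (key t ht).2) hτ

/-- Bounded solutions of the inhomogeneous scalar equation. -/
theorem exists_eq_mul_pc_add_green {F y v : ℝ → ℝ} {b : ℝ} (hb : 0 < b)
    (hF : ContinuousOn F (Ici 0)) (hy : ContinuousOn y (Icc 0 b)) (hv : ContinuousOn v (Icc 0 b))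
    (hy' : ∀ τ ∈ Ioc 0 b, HasDerivWithinAt y (v τ) (Icc 0 b) τ)
    (hv' : ∀ τ ∈ Ioc 0 b, HasDerivWithinAt v
      (F τ - y τ - Real.cosh τ / Real.sinh τ * v τ) (Icc 0 b) τ) :
    ∃ x : ℝ, ∀ τ ∈ Icc 0 b, y τ = x * pc τ + greenFun F τ ∧ v τ = x * pc1 τ + greenFun' F τ := by
  obtain ⟨hg, hg'⟩ := continuousOn_green hF b
  obtain ⟨x, hx⟩ := exists_eq_mul_pc (y := fun t => y t - greenFun F t)
    (v := fun t => v t - greenFun' F t) hb (hy.sub hg) (hv.sub hg')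
    (fun τ hτ => (hy' τ hτ).sub (hasDerivAt_greenFun hF hτ.1).hasDerivWithinAt)
    (fun τ hτ => ((hv' τ hτ).sub (hasDerivAt_greenFun' hF hτ.1).hasDerivWithinAt).congr_deriv
      (by ring))
  refine ⟨x, fun τ hτ => ?_⟩
  obtain ⟨h1, h2⟩ := hx τ hτ
  constructor <;> linarith

/-! ### Solution operators on C[0, τ₀] and the integral equation. -/

section Operators

variable {τ₀ : ℝ} (h : 0 < τ₀)

/-- The extension of a function in `C[0, τ₀]` to the line. -/
def ext (f : C(Icc (0 : ℝ) τ₀, ℝ)) : ℝ → ℝ := Set.IccExtend h.le f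

theorem continuous_ext (f : C(Icc (0 : ℝ) τ₀, ℝ)) : Continuous (ext h f) :=
  f.continuous.Icc_extend'

theorem ext_apply (f : C(Icc (0 : ℝ) τ₀, ℝ)) {τ : ℝ} (hτ : τ ∈ Icc 0 τ₀) :
    ext h f τ = f ⟨τ, hτ⟩ := Set.IccExtend_of_mem _ _ hτ

theorem abs_ext_le (f : C(Icc (0 : ℝ) τ₀, ℝ)) (τ : ℝ) : |ext h f τ| ≤ ‖f‖ :=
  f.norm_coe_le_norm _

theorem momP_add (f g : C(Icc (0 : ℝ) τ₀, ℝ)) {τ : ℝ} (hτ : 0 ≤ τ) :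
    momP (ext h (f + g)) τ = momP (ext h f) τ + momP (ext h g) τ := by
  rw [momP, momP, momP, ← intervalIntegral.integral_add
    (intervalIntegrable_of_continuousOn_Ici
      (continuousOn_momP_integrand (continuous_ext h f).continuousOn) hτ)
    (intervalIntegrable_of_continuousOn_Ici
      (continuousOn_momP_integrand (continuous_ext h g).continuousOn) hτ)]
  congr 1; ext s
  change pc s * (ext h f s + ext h g s) * Real.sinh s = _
  ring

theorem momQ_add (f g : C(Icc (0 : ℝ) τ₀, ℝ)) {τ : ℝ} (hτ : 0 ≤ τ) :
    momQ (ext h (f + g)) τ = momQ (ext h f) τ + momQ (ext h g) τ := by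
  rw [momQ, momQ, momQ, ← intervalIntegral.integral_add
    (intervalIntegrable_of_continuousOn_Ici
      (continuousOn_momQ_integrand (continuous_ext h f).continuousOn) hτ)
    (intervalIntegrable_of_continuousOn_Ici
      (continuousOn_momQ_integrand (continuous_ext h g).continuousOn) hτ)]
  congr 1; ext s
  change qc s * (ext h f s + ext h g s) * Real.sinh s = _
  ring

theorem momP_smul (c : ℝ) (f : C(Icc (0 : ℝ) τ₀, ℝ)) (τ : ℝ) :
    momP (ext h (c • f)) τ = c * momP (ext h f) τ := by
  rw [momP, momP, ← intervalIntegral.integral_const_mul]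
  congr 1; ext s
  change pc s * (c * ext h f s) * Real.sinh s = _
  ring

theorem momQ_smul (c : ℝ) (f : C(Icc (0 : ℝ) τ₀, ℝ)) (τ : ℝ) :
    momQ (ext h (c • f)) τ = c * momQ (ext h f) τ := by
  rw [momQ, momQ, ← intervalIntegral.integral_const_mul]
  congr 1; ext s
  change qc s * (c * ext h f s) * Real.sinh s = _
  ring

/-- `greenFun` as a bounded operator on `C[0, τ₀]`. -/
def greenOp : C(Icc (0 : ℝ) τ₀, ℝ) →L[ℝ] C(Icc (0 : ℝ) τ₀, ℝ) :=
  LinearMap.mkContinuousOfExistsBound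
    { toFun := fun f => ⟨fun τ => greenFun (ext h f) τ, continuousOn_iff_continuous_domRestrict.1
        (continuousOn_green (continuous_ext h f).continuousOn τ₀).1⟩
      map_add' := fun f g => by
        ext τ
        simp only [ContinuousMap.coe_mk, ContinuousMap.add_apply, greenFun, momP_add h f g τ.2.1,
          momQ_add h f g τ.2.1]
        ring
      map_smul' := fun c f => by
        ext τ
        simp only [ContinuousMap.coe_mk, ContinuousMap.smul_apply, greenFun, momP_smul, momQ_smul,
          smul_eq_mul, RingHom.id_apply]
        ring } <| by
    obtain ⟨B, -, hB⟩ := exists_core_bound τ₀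
    refine ⟨2 * B ^ 2 * τ₀, fun f => (ContinuousMap.norm_le _ (by positivity)).2 fun τ => ?_⟩
    refine (abs_green_le hB (fun t _ => abs_ext_le h f t) τ.2).1.trans ?_
    calc 2 * B ^ 2 * ‖f‖ * (τ : ℝ) ≤ 2 * B ^ 2 * ‖f‖ * τ₀ := by gcongr; exact τ.2.2
      _ = _ := by ring

/-- `greenFun'` as a bounded operator on `C[0, τ₀]`. -/
def greenOp' : C(Icc (0 : ℝ) τ₀, ℝ) →L[ℝ] C(Icc (0 : ℝ) τ₀, ℝ) :=
  LinearMap.mkContinuousOfExistsBound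
    { toFun := fun f => ⟨fun τ => greenFun' (ext h f) τ, continuousOn_iff_continuous_domRestrict.1
        (continuousOn_green (continuous_ext h f).continuousOn τ₀).2⟩
      map_add' := fun f g => by
        ext τ
        simp only [ContinuousMap.coe_mk, ContinuousMap.add_apply, greenFun', momP_add h f g τ.2.1,
          momQ_add h f g τ.2.1]
        ring
      map_smul' := fun c f => by
        ext τ
        simp only [ContinuousMap.coe_mk, ContinuousMap.smul_apply, greenFun', momP_smul, momQ_smul,
          smul_eq_mul, RingHom.id_apply]
        ring } <| by
    obtain ⟨B, -, hB⟩ := exists_core_bound τ₀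
    refine ⟨2 * B ^ 2 * τ₀, fun f => (ContinuousMap.norm_le _ (by positivity)).2 fun τ => ?_⟩
    refine (abs_green_le hB (fun t _ => abs_ext_le h f t) τ.2).2.trans ?_
    calc 2 * B ^ 2 * ‖f‖ * (τ : ℝ) ≤ 2 * B ^ 2 * ‖f‖ * τ₀ := by gcongr; exact τ.2.2
      _ = _ := by ring

theorem greenOp_apply (f : C(Icc (0 : ℝ) τ₀, ℝ)) (τ : Icc (0 : ℝ) τ₀) :
    greenOp h f τ = greenFun (ext h f) τ := rfl

theorem greenOp'_apply (f : C(Icc (0 : ℝ) τ₀, ℝ)) (τ : Icc (0 : ℝ) τ₀) :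
    greenOp' h f τ = greenFun' (ext h f) τ := rfl

/-- `P` as an element of `C[0, τ₀]`. -/
def pcMap (τ₀ : ℝ) : C(Icc (0 : ℝ) τ₀, ℝ) :=
  ⟨fun τ => pc τ, continuousOn_iff_continuous_domRestrict.1
    (continuousOn_pc.mono Icc_subset_Ici_self)⟩

/-- `P¹` as an element of `C[0, τ₀]`. -/
def pc1Map (τ₀ : ℝ) : C(Icc (0 : ℝ) τ₀, ℝ) :=
  ⟨fun τ => pc1 τ, continuousOn_iff_continuous_domRestrict.1
    (continuousOn_pc1.mono Icc_subset_Ici_self)⟩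

theorem pcMap_apply (τ : Icc (0 : ℝ) τ₀) : pcMap τ₀ τ = pc τ := rfl

theorem pc1Map_apply (τ : Icc (0 : ℝ) τ₀) : pc1Map τ₀ τ = pc1 τ := rfl

/-- The `i`-th coordinate of a curve in phase space. -/
def coord (τ₀ : ℝ) (i : Fin 4) : C(Icc (0 : ℝ) τ₀, E4) →L[ℝ] C(Icc (0 : ℝ) τ₀, ℝ) :=
  (EuclideanSpace.proj i : E4 →L[ℝ] ℝ).compLeftContinuous ℝ _

theorem coord_apply (i : Fin 4) (U : C(Icc (0 : ℝ) τ₀, E4)) (τ : Icc (0 : ℝ) τ₀) :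
    coord τ₀ i U τ = U τ i := rfl

/-- The curve with constant direction the `i`-th basis vector and given coordinate. -/
def axisCurve (τ₀ : ℝ) (i : Fin 4) : C(Icc (0 : ℝ) τ₀, ℝ) →L[ℝ] C(Icc (0 : ℝ) τ₀, E4) :=
  (ContinuousLinearMap.toSpanSingleton ℝ (EuclideanSpace.single i (1 : ℝ) : E4)).compLeftContinuous
    ℝ _

theorem axisCurve_apply (i j : Fin 4) (f : C(Icc (0 : ℝ) τ₀, ℝ)) (τ : Icc (0 : ℝ) τ₀) :
    axisCurve τ₀ i f τ j = if j = i then f τ else 0 := by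
  simp [axisCurve]

/-- The solution of the linear system with forcing `f` in the last component that is regular at `0`
and has `u₁(0) = u₂(0) = 0`. -/
def particularSol : C(Icc (0 : ℝ) τ₀, ℝ) →L[ℝ] C(Icc (0 : ℝ) τ₀, E4) :=
  (axisCurve τ₀ 0).comp ((greenOp h).comp (greenOp h)) + (axisCurve τ₀ 1).comp (greenOp h)
    + (axisCurve τ₀ 2).comp ((greenOp' h).comp (greenOp h)) + (axisCurve τ₀ 3).comp (greenOp' h)

theorem particularSol_apply (f : C(Icc (0 : ℝ) τ₀, ℝ)) (τ : Icc (0 : ℝ) τ₀) :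
    particularSol h f τ = !₂[greenOp h (greenOp h f) τ, greenOp h f τ,
      greenOp' h (greenOp h f) τ, greenOp' h f τ] := by
  ext j
  simp only [particularSol, add_apply, ContinuousLinearMap.comp_apply,
    ContinuousMap.add_apply, PiLp.add_apply, axisCurve_apply]
  fin_cases j <;> simp

/-- The regular solutions of the homogeneous linear system. -/
def regularSol : E2 →L[ℝ] C(Icc (0 : ℝ) τ₀, E4) :=
  (EuclideanSpace.proj 0 : E2 →L[ℝ] ℝ).smulRight
      (axisCurve τ₀ 0 (pcMap τ₀) + axisCurve τ₀ 2 (pc1Map τ₀))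
    + (EuclideanSpace.proj 1 : E2 →L[ℝ] ℝ).smulRight
      (axisCurve τ₀ 0 (greenOp h (pcMap τ₀)) + axisCurve τ₀ 1 (pcMap τ₀)
        + axisCurve τ₀ 2 (greenOp' h (pcMap τ₀)) + axisCurve τ₀ 3 (pc1Map τ₀))

theorem regularSol_apply (x : E2) (τ : Icc (0 : ℝ) τ₀) :
    regularSol h x τ = !₂[x 0 * pc τ + x 1 * greenOp h (pcMap τ₀) τ, x 1 * pc τ,
      x 0 * pc1 τ + x 1 * greenOp' h (pcMap τ₀) τ, x 1 * pc1 τ] := by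
  ext j
  simp only [regularSol, add_apply, ContinuousLinearMap.smulRight_apply,
    ContinuousMap.add_apply, ContinuousMap.smul_apply, PiLp.add_apply, PiLp.smul_apply,
    axisCurve_apply]
  fin_cases j <;> simp [pcMap_apply, pc1Map_apply]

/-- The first and third components of V₂ are thus the Green response to the forcing u₂ = P. -/
theorem green_pcMap {τ : ℝ} (hτ : τ ∈ Icc 0 τ₀) :
    greenFun (ext h (pcMap τ₀)) τ = pc τ * intPQ τ - qc τ * intPP τ ∧
    greenFun' (ext h (pcMap τ₀)) τ = pc1 τ * intPQ τ - qc1 τ * intPP τ := by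
  have hP : momP (ext h (pcMap τ₀)) τ = intPP τ := by
    refine intervalIntegral.integral_congr fun s hs => ?_
    rw [uIcc_of_le hτ.1] at hs
    simp only [ext_apply h _ (⟨hs.1, hs.2.trans hτ.2⟩ : s ∈ Icc 0 τ₀),
      pcMap_apply]
    ring
  have hQ : momQ (ext h (pcMap τ₀)) τ = intPQ τ := by
    refine intervalIntegral.integral_congr fun s hs => ?_
    rw [uIcc_of_le hτ.1] at hs
    simp only [ext_apply h _ (⟨hs.1, hs.2.trans hτ.2⟩ : s ∈ Icc 0 τ₀),
      pcMap_apply]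
    ring
  rw [greenFun, greenFun', hP, hQ]
  exact ⟨rfl, rfl⟩

theorem regularSol_eq (x : E2) (τ : Icc (0 : ℝ) τ₀) :
    regularSol h x τ = x 0 • V1 τ + x 1 • V2 τ := by
  rw [regularSol_apply, greenOp_apply, greenOp'_apply, (green_pcMap h τ.2).1, (green_pcMap h τ.2).2]
  ext j
  fin_cases j <;> simp [V1, V2]

/-- The vector field of the system in coordinates. -/
theorem coreField_apply (ν η lam τ : ℝ) (u : E4) :
    (coreA τ).toEuclideanLin u + coreF ν η lam u =
      !₂[u 2, u 3, -u 0 + u 1 - Real.cosh τ / Real.sinh τ * u 2,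
        -u 1 - Real.cosh τ / Real.sinh τ * u 3 + (lam * u 0 + ν * u 0 ^ 2 - η * u 0 ^ 3)] := by
  ext j
  fin_cases j <;>
    simp [coreA, coreF, Matrix.toLpLin_apply, dotProduct,
      Fin.sum_univ_four] <;> ring

theorem isCoreSolution_iff (ν η lam : ℝ) (U : C(Icc (0 : ℝ) τ₀, E4)) :
    IsCoreSolution ν η lam h U ↔ ∀ τ ∈ Ioc 0 τ₀,
      HasDerivWithinAt (ext h (coord τ₀ 0 U)) (ext h (coord τ₀ 2 U) τ) (Icc 0 τ₀) τ ∧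
      HasDerivWithinAt (ext h (coord τ₀ 1 U)) (ext h (coord τ₀ 3 U) τ) (Icc 0 τ₀) τ ∧
      HasDerivWithinAt (ext h (coord τ₀ 2 U)) (ext h (coord τ₀ 1 U) τ - ext h (coord τ₀ 0 U) τ
        - Real.cosh τ / Real.sinh τ * ext h (coord τ₀ 2 U) τ) (Icc 0 τ₀) τ ∧
      HasDerivWithinAt (ext h (coord τ₀ 3 U)) (ext h (cubic ν η lam (coord τ₀ 0 U)) τ
        - ext h (coord τ₀ 1 U) τ
        - Real.cosh τ / Real.sinh τ * ext h (coord τ₀ 3 U) τ) (Icc 0 τ₀) τ := by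
  have hU : ∀ τ : ℝ, τ ∈ Ioc 0 τ₀ → ∀ (v : E4),
      HasDerivWithinAt (Set.IccExtend h.le U) v (Icc 0 τ₀) τ ↔
      ∀ i, HasDerivWithinAt (ext h (coord τ₀ i U)) (v i) (Icc 0 τ₀) τ := by
    intro τ _ v
    rw [hasDerivWithinAt_iff_hasFDerivWithinAt, hasFDerivWithinAt_euclidean]
    refine forall_congr' fun i => ?_
    rw [hasDerivWithinAt_iff_hasFDerivWithinAt]
    have e1 : (fun x => (Set.IccExtend h.le U x) i) = ext h (coord τ₀ i U) := rfl
    have e2 : (EuclideanSpace.proj i : E4 →L[ℝ] ℝ).comp (ContinuousLinearMap.toSpanSingleton ℝ v)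
        = ContinuousLinearMap.toSpanSingleton ℝ (v i) := by
      ext; simp
    rw [e1, e2]
  have hval : ∀ (τ : Icc (0 : ℝ) τ₀) (f : C(Icc (0 : ℝ) τ₀, ℝ)), ext h f τ = f τ := fun τ f =>
    ext_apply h f τ.2
  unfold IsCoreSolution
  constructor
  · intro H τ hτ
    have hm := Ioc_subset_Icc_self hτ
    have key := (hU τ hτ _).1 (H ⟨τ, hm⟩ hτ.1)
    have k0 := key 0
    have k1 := key 1
    have k2 := key 2
    have k3 := key 3
    rw [coreField_apply] at k0 k1 k2 k3
    refine ⟨k0.congr_deriv ?_, k1.congr_deriv ?_, k2.congr_deriv ?_, k3.congr_deriv ?_⟩ <;>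
      simp only [ext_apply h _ hm] <;> simp [coord_apply, cubic] <;> ring
  · intro H τ hτ
    have hm : (τ : ℝ) ∈ Ioc 0 τ₀ := ⟨hτ, τ.2.2⟩
    obtain ⟨k0, k1, k2, k3⟩ := H τ hm
    refine (hU τ hm _).2 fun i => ?_
    rw [coreField_apply]
    simp only [hval] at k0 k1 k2 k3
    fin_cases i
    · exact k0.congr_deriv (by simp [coord_apply])
    · exact k1.congr_deriv (by simp [coord_apply])
    · exact k2.congr_deriv (by simp [coord_apply]; ring)
    · exact k3.congr_deriv (by simp [coord_apply, cubic]; ring)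

/-- Continuous solutions on `[0, τ₀]` are the regular solutions of the integral equation. -/
theorem isCoreSolution_iff_exists (ν η lam : ℝ) (U : C(Icc (0 : ℝ) τ₀, E4)) :
    IsCoreSolution ν η lam h U ↔
      ∃ x : E2, U = regularSol h x + particularSol h (cubic ν η lam (coord τ₀ 0 U)) := by
  rw [isCoreSolution_iff]
  constructor
  · intro H
    have hc : ∀ f : C(Icc (0 : ℝ) τ₀, ℝ), ContinuousOn (ext h f) (Icc 0 τ₀) := fun f =>
      (continuous_ext h f).continuousOn
    -- The triangular structure: u₂ is forced by the cubic term, then u₁ is forced by u₂.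
    obtain ⟨x1, h1⟩ := exists_eq_mul_pc_add_green h
      (continuous_ext h (cubic ν η lam (coord τ₀ 0 U))).continuousOn
      (hc (coord τ₀ 1 U)) (hc (coord τ₀ 3 U)) (fun τ hτ => (H τ hτ).2.1)
      (fun τ hτ => (H τ hτ).2.2.2)
    obtain ⟨x0, h0⟩ := exists_eq_mul_pc_add_green h
      (continuous_ext h (coord τ₀ 1 U)).continuousOn
      (hc (coord τ₀ 0 U)) (hc (coord τ₀ 2 U)) (fun τ hτ => (H τ hτ).1)
      (fun τ hτ => (H τ hτ).2.2.1)
    have hu1 : coord τ₀ 1 U = x1 • pcMap τ₀ + greenOp h (cubic ν η lam (coord τ₀ 0 U)) := by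
      ext τ
      have := (h1 τ τ.2).1
      rwa [ext_apply h _ τ.2] at this
    refine ⟨!₂[x0, x1], ?_⟩
    have hg : greenOp h (coord τ₀ 1 U) = x1 • greenOp h (pcMap τ₀) +
        greenOp h (greenOp h (cubic ν η lam (coord τ₀ 0 U))) := by
      rw [← map_smul, ← map_add, ← hu1]
    have hg' : greenOp' h (coord τ₀ 1 U) = x1 • greenOp' h (pcMap τ₀) +
        greenOp' h (greenOp h (cubic ν η lam (coord τ₀ 0 U))) := by
      rw [← map_smul, ← map_add, ← hu1]
    ext τ j
    obtain ⟨a1, a3⟩ := h1 τ τ.2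
    obtain ⟨a0, a2⟩ := h0 τ τ.2
    rw [← greenOp_apply, ext_apply h _ τ.2, coord_apply] at a0 a1
    rw [← greenOp'_apply, ext_apply h _ τ.2, coord_apply] at a2 a3
    rw [hg] at a0
    rw [hg'] at a2
    simp only [ContinuousMap.add_apply, ContinuousMap.smul_apply, smul_eq_mul] at a0 a2
    rw [ContinuousMap.add_apply, PiLp.add_apply, regularSol_apply, particularSol_apply]
    fin_cases j
    · change U τ 0 = _; rw [a0]; simp; ring
    · change U τ 1 = _; rw [a1]; simp
    · change U τ 2 = _; rw [a2]; simp; ring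
    · change U τ 3 = _; rw [a3]; simp
  · rintro ⟨x, hx⟩ τ hτ
    set f := cubic ν η lam (coord τ₀ 0 U) with hf
    have hu : ∀ t : Icc (0 : ℝ) τ₀, U t = regularSol h x t + particularSol h f t := fun t =>
      congrArg (fun W : C(Icc (0 : ℝ) τ₀, E4) => W t) hx
    have c1 : coord τ₀ 1 U = x 1 • pcMap τ₀ + greenOp h f := by
      ext t
      rw [coord_apply, hu, PiLp.add_apply, regularSol_apply, particularSol_apply]
      simp [pcMap_apply]
    have c3 : coord τ₀ 3 U = x 1 • pc1Map τ₀ + greenOp' h f := by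
      ext t
      rw [coord_apply, hu, PiLp.add_apply, regularSol_apply, particularSol_apply]
      simp [pc1Map_apply]
    have c0 : coord τ₀ 0 U = x 0 • pcMap τ₀ + greenOp h (coord τ₀ 1 U) := by
      rw [c1, map_add, map_smul]
      ext t
      rw [coord_apply, hu, PiLp.add_apply, regularSol_apply, particularSol_apply]
      simp [pcMap_apply]; ring
    have c2 : coord τ₀ 2 U = x 0 • pc1Map τ₀ + greenOp' h (coord τ₀ 1 U) := by
      rw [c1, map_add, map_smul]
      ext t
      rw [coord_apply, hu, PiLp.add_apply, regularSol_apply, particularSol_apply]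
      simp [pc1Map_apply]; ring
    have hscal : ∀ (y v F : C(Icc (0 : ℝ) τ₀, ℝ)) (c : ℝ), y = c • pcMap τ₀ + greenOp h F →
        v = c • pc1Map τ₀ + greenOp' h F →
        HasDerivWithinAt (ext h y) (ext h v τ) (Icc 0 τ₀) τ ∧
        HasDerivWithinAt (ext h v) (ext h F τ - ext h y τ
          - Real.cosh τ / Real.sinh τ * ext h v τ) (Icc 0 τ₀) τ := by
      intro y v F c hy hv
      have hm := Ioc_subset_Icc_self hτ
      have ey : ∀ t ∈ Icc 0 τ₀, ext h y t = c * pc t + greenFun (ext h F) t := by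
        intro t ht; rw [ext_apply h _ ht, hy]; rfl
      have ev : ∀ t ∈ Icc 0 τ₀, ext h v t = c * pc1 t + greenFun' (ext h F) t := by
        intro t ht; rw [ext_apply h _ ht, hv]; rfl
      have hF := (continuous_ext h F).continuousOn (s := Ici 0)
      constructor
      · refine HasDerivWithinAt.congr ?_ ey (ey τ hm)
        rw [ev τ hm]
        exact (((hasDerivAt_pc hτ.1).const_mul c).add
          (hasDerivAt_greenFun hF hτ.1)).hasDerivWithinAt
      · refine HasDerivWithinAt.congr ?_ ev (ev τ hm)
        rw [ev τ hm, ey τ hm]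
        exact ((((hasDerivAt_pc1 hτ.1).const_mul c).add
          (hasDerivAt_greenFun' hF hτ.1)).congr_deriv (by ring)).hasDerivWithinAt
    obtain ⟨d0, d2⟩ := hscal _ _ _ _ c0 c2
    obtain ⟨d1, d3⟩ := hscal _ _ _ _ c1 c3
    exact ⟨d0, d1, d2, d3⟩

end Operators

/-! ### Coordinates in the frame V₁, ..., V₄. -/

section Frame

/-- The coefficient of `P` in a scalar solution with value `u i` and derivative `u j`. -/
def coefP (τ : ℝ) (i j : Fin 4) : E4 →L[ℝ] ℝ :=
  Real.sinh τ • (qc τ • EuclideanSpace.proj j - qc1 τ • EuclideanSpace.proj i)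

/-- The coefficient of `Q` in a scalar solution with value `u i` and derivative `u j`. -/
def coefQ (τ : ℝ) (i j : Fin 4) : E4 →L[ℝ] ℝ :=
  -(Real.sinh τ • (pc τ • EuclideanSpace.proj j - pc1 τ • EuclideanSpace.proj i))

/-- The coordinates with respect to the frame `V₁(τ), …, V₄(τ)`. -/
def frameCoef (τ : ℝ) : Fin 4 → E4 →L[ℝ] ℝ :=
  ![coefP τ 0 2 - intPQ τ • coefP τ 1 3 - intQQ τ • coefQ τ 1 3, coefP τ 1 3,
    coefQ τ 0 2 + intPP τ • coefP τ 1 3 + intPQ τ • coefQ τ 1 3, coefQ τ 1 3]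

theorem coefP_apply (τ : ℝ) (i j : Fin 4) (u : E4) :
    coefP τ i j u = Real.sinh τ * (qc τ * u j - qc1 τ * u i) := rfl

theorem coefQ_apply (τ : ℝ) (i j : Fin 4) (u : E4) :
    coefQ τ i j u = -(Real.sinh τ * (pc τ * u j - pc1 τ * u i)) := rfl

theorem frameCoef_zero (τ : ℝ) (u : E4) : frameCoef τ 0 u =
    coefP τ 0 2 u - intPQ τ * coefP τ 1 3 u - intQQ τ * coefQ τ 1 3 u := rfl

theorem frameCoef_one (τ : ℝ) (u : E4) : frameCoef τ 1 u = coefP τ 1 3 u := rfl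

theorem frameCoef_two (τ : ℝ) (u : E4) : frameCoef τ 2 u =
    coefQ τ 0 2 u + intPP τ * coefP τ 1 3 u + intPQ τ * coefQ τ 1 3 u := rfl

theorem frameCoef_three (τ : ℝ) (u : E4) : frameCoef τ 3 u = coefQ τ 1 3 u := rfl

theorem frameComb (τ : ℝ) (c : Fin 4 → ℝ) :
    ∑ j, c j • frame τ j = c 0 • V1 τ + c 1 • V2 τ + c 2 • V3 τ + c 3 • V4 τ := by
  rw [Fin.sum_univ_four]; rfl

theorem frameComb_apply (τ : ℝ) (c : Fin 4 → ℝ) (i : Fin 4) :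
    (∑ j, c j • frame τ j) i =
      ![(c 0 + c 1 * intPQ τ + c 3 * intQQ τ) * pc τ + (c 2 - c 1 * intPP τ - c 3 * intPQ τ) * qc τ,
        c 1 * pc τ + c 3 * qc τ,
        (c 0 + c 1 * intPQ τ + c 3 * intQQ τ) * pc1 τ
          + (c 2 - c 1 * intPP τ - c 3 * intPQ τ) * qc1 τ,
        c 1 * pc1 τ + c 3 * qc1 τ] i := by
  rw [frameComb]
  fin_cases i <;> simp [V1, V2, V3, V4] <;> ring

/-- Components (1, 3) and (0, 2) are each a combination of (P, P¹) and (Q, Q¹), solved by Cramer's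
rule with the Wronskian. The pair (1, 3) gives c₁ and c₃; the pair (0, 2) gives c₀ and c₂ after
subtracting their contributions. -/
theorem frameCoef_frameComb {τ : ℝ} (hτ : 0 < τ) (c : Fin 4 → ℝ) (i : Fin 4) :
    frameCoef τ i (∑ j, c j • frame τ j) = c i := by
  have hW := wronskian hτ
  have hP : ∀ i j : Fin 4, ∀ x y : ℝ, ∀ u : E4, u i = x * pc τ + y * qc τ →
      u j = x * pc1 τ + y * qc1 τ → coefP τ i j u = x ∧ coefQ τ i j u = y := by
    intro i j x y u h1 h2
    rw [coefP_apply, coefQ_apply, h1, h2]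
    exact ⟨by linear_combination x * hW, by linear_combination y * hW⟩
  obtain ⟨a1, a2⟩ := hP 0 2 _ _ _ (frameComb_apply τ c 0) (frameComb_apply τ c 2)
  obtain ⟨b1, b2⟩ := hP 1 3 _ _ _ (frameComb_apply τ c 1) (frameComb_apply τ c 3)
  fin_cases i
  · change frameCoef τ 0 _ = c 0
    rw [frameCoef_zero, a1, b1, b2]; ring
  · change frameCoef τ 1 _ = c 1
    rw [frameCoef_one, b1]
  · change frameCoef τ 2 _ = c 2
    rw [frameCoef_two, a2, b1, b2]; ring
  · change frameCoef τ 3 _ = c 3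
    rw [frameCoef_three, b2]

theorem sum_frameCoef_smul {τ : ℝ} (hτ : 0 < τ) (u : E4) : ∑ j, frameCoef τ j u • frame τ j = u := by
  have hW := wronskian hτ
  ext i
  rw [frameComb_apply, frameCoef_zero, frameCoef_one, frameCoef_two, frameCoef_three]
  simp only [coefP_apply, coefQ_apply]
  fin_cases i
  · simp; linear_combination u 0 * hW
  · simp; linear_combination u 1 * hW
  · simp; linear_combination u 2 * hW
  · simp; linear_combination u 3 * hW

theorem linearIndependent_frame {τ : ℝ} (hτ : 0 < τ) : LinearIndependent ℝ (frame τ) := by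
  rw [Fintype.linearIndependent_iff]
  intro g hg i
  rw [← frameCoef_frameComb hτ g i, hg, map_zero]

/-- The functionals `frameCoef` recover c, so the frame matrix is injective, hence invertible, and
its inverse in the definition of `coreProj` is genuine. -/
theorem coreProj_frameComb {τ : ℝ} (hτ : 0 < τ) (c : Fin 4 → ℝ) :
    coreProj τ (∑ j, c j • frame τ j) = c 0 • V1 τ + c 1 • V2 τ := by
  have hmul : ∀ c : Fin 4 → ℝ, (frameMatrix τ).mulVec c = (∑ j, c j • frame τ j).ofLp := by
    intro c
    ext i
    simp [frameMatrix, Matrix.mulVec, dotProduct, Fin.sum_univ_four, mul_comm]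
  have hunit : IsUnit (frameMatrix τ) := by
    rw [← Matrix.mulVec_injective_iff_isUnit]
    intro c c' hcc
    simp only [hmul] at hcc
    ext i
    rw [← frameCoef_frameComb hτ c i, WithLp.ofLp_injective _ hcc, frameCoef_frameComb hτ c' i]
  have hinv : (frameMatrix τ)⁻¹ * frameMatrix τ = 1 :=
    Matrix.nonsing_inv_mul _ ((Matrix.isUnit_iff_isUnit_det _).1 hunit)
  rw [coreProj, Matrix.toLpLin_apply, ← hmul, Matrix.mulVec_mulVec, Matrix.mul_assoc, hinv,
    Matrix.mul_one, ← Matrix.mulVec_mulVec, hmul, WithLp.toLp_ofLp, frameComb]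
  simp [Matrix.mulVec_diagonal]

end Frame

/-! ### Backward uniqueness from the endpoint. -/

section Uniqueness

variable {τ₀ : ℝ} (h : 0 < τ₀)

/-- Solutions of the system are determined by their value at `τ₀`. -/
theorem IsCoreSolution.eq_of_endpoint {ν η lam : ℝ} {U V : C(Icc (0 : ℝ) τ₀, E4)}
    (hU : IsCoreSolution ν η lam h U) (hV : IsCoreSolution ν η lam h V)
    (hUV : U ⟨τ₀, right_mem_Icc.2 h.le⟩ = V ⟨τ₀, right_mem_Icc.2 h.le⟩) : U = V := by
  rw [isCoreSolution_iff] at hU hV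
  set D : Fin 4 → ℝ → ℝ := fun i t => ext h (coord τ₀ i U) t - ext h (coord τ₀ i V) t with hD
  have hDc : ∀ i, Continuous (D i) := fun i => (continuous_ext h _).sub (continuous_ext h _)
  set G : ℝ → ℝ := fun t => ext h (cubic ν η lam (coord τ₀ 0 U)) t
    - ext h (cubic ν η lam (coord τ₀ 0 V)) t with hG
  obtain ⟨H, hH0, hH⟩ : ∃ H : ℝ, 0 ≤ H ∧ ∀ t, |G t| ≤ H * |D 0 t| := by
    set s := max ‖coord τ₀ 0 U‖ ‖coord τ₀ 0 V‖ with hs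
    have hs0 : 0 ≤ s := (norm_nonneg _).trans (le_max_left _ _)
    refine ⟨|lam| + 2 * |ν| * s + 3 * |η| * s ^ 2, by positivity, fun t => ?_⟩
    exact norm_cubic_sub_le ν η lam (u := ext h (coord τ₀ 0 U) t) (v := ext h (coord τ₀ 0 V) t)
      ((abs_ext_le h _ t).trans (le_max_left _ _)) ((abs_ext_le h _ t).trans (le_max_right _ _))
  -- On [ε, τ₀] coth is bounded, so for K large |D|² e^{Kt} is nondecreasing. It is zero at τ₀,
  -- hence zero throughout. No smallness of the solutions is used.
  have hzero : ∀ ε ∈ Ioo 0 τ₀, ∀ i, D i ε = 0 := by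
    intro ε hε
    set C := Real.cosh τ₀ / Real.sinh ε with hC
    set K := 1 + 2 * C + H with hK
    set N : ℝ → ℝ := fun t => (D 0 t ^ 2 + D 1 t ^ 2 + D 2 t ^ 2 + D 3 t ^ 2) * Real.exp (K * t)
      with hN
    have hNd : ∀ t ∈ Ioo ε τ₀, HasDerivAt N ((2 * D 1 t * D 2 t
        - 2 * (Real.cosh t / Real.sinh t) * D 2 t ^ 2 + 2 * D 3 t * G t
        - 2 * (Real.cosh t / Real.sinh t) * D 3 t ^ 2
        + K * (D 0 t ^ 2 + D 1 t ^ 2 + D 2 t ^ 2 + D 3 t ^ 2)) * Real.exp (K * t)) t := by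
      intro t ht
      have ht0 : 0 < t := hε.1.trans ht.1
      have hn : Icc 0 τ₀ ∈ 𝓝 t := Icc_mem_nhds ht0 ht.2
      obtain ⟨u0, u1, u2, u3⟩ := hU t ⟨ht0, ht.2.le⟩
      obtain ⟨v0, v1, v2, v3⟩ := hV t ⟨ht0, ht.2.le⟩
      have d0 := (u0.sub v0).hasDerivAt hn
      have d1 := (u1.sub v1).hasDerivAt hn
      have d2 := (u2.sub v2).hasDerivAt hn
      have d3 := (u3.sub v3).hasDerivAt hn
      have dexp : HasDerivAt (fun t => Real.exp (K * t)) (Real.exp (K * t) * (K * 1)) t :=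
        ((hasDerivAt_id t).const_mul K).exp
      refine ((((((d0.pow 2).add (d1.pow 2)).add (d2.pow 2)).add (d3.pow 2)).mul dexp)).congr_deriv ?_
      simp only [Pi.add_apply, Pi.pow_apply, Pi.sub_apply, hD, hG]
      push_cast
      ring
    have hmono : MonotoneOn N (Icc ε τ₀) := by
      refine monotoneOn_of_deriv_nonneg (convex_Icc _ _) ?_ ?_ ?_
      · refine Continuous.continuousOn ?_
        exact (((((hDc 0).pow 2).add ((hDc 1).pow 2)).add ((hDc 2).pow 2)).add
          ((hDc 3).pow 2)).mul (by fun_prop)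
      · rw [interior_Icc]
        exact fun t ht => (hNd t ht).differentiableAt.differentiableWithinAt
      · rw [interior_Icc]
        intro t ht
        rw [(hNd t ht).deriv]
        have hse := Real.sinh_pos_iff.2 hε.1
        have ht0 : 0 < t := hε.1.trans ht.1
        have hc : Real.cosh t / Real.sinh t ≤ C := by
          have e1 : Real.cosh t ≤ Real.cosh τ₀ :=
            Real.cosh_le_cosh.2 (by rw [abs_of_pos ht0, abs_of_pos h]; exact ht.2.le)
          have e2 : Real.sinh ε ≤ Real.sinh t := Real.sinh_le_sinh.2 ht.1.le
          have := Real.cosh_pos t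
          rw [hC]; gcongr
        have hc0 : 0 ≤ Real.cosh t / Real.sinh t :=
          div_nonneg (Real.cosh_pos t).le (Real.sinh_pos_iff.2 ht0).le
        have hg : -(H * (D 0 t ^ 2 + D 3 t ^ 2)) ≤ 2 * D 3 t * G t := by
          have e1 := neg_abs_le (2 * D 3 t * G t)
          have e2 : |2 * D 3 t * G t| ≤ 2 * |D 3 t| * (H * |D 0 t|) := by
            rw [abs_mul, abs_mul, abs_two]; gcongr; exact hH t
          have e3 := mul_nonneg hH0 (sq_nonneg (|D 3 t| - |D 0 t|))
          have e4 := sq_abs (D 3 t)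
          have e5 := sq_abs (D 0 t)
          nlinarith
        refine mul_nonneg ?_ (Real.exp_pos _).le
        rw [hK]
        have f2 := mul_le_mul_of_nonneg_right hc (sq_nonneg (D 2 t))
        have f3 := mul_le_mul_of_nonneg_right hc (sq_nonneg (D 3 t))
        have hC0 := hc0.trans hc
        have f4 := sq_nonneg (D 1 t + D 2 t)
        have f5 := mul_nonneg hC0 (sq_nonneg (D 0 t))
        have f6 := mul_nonneg hC0 (sq_nonneg (D 1 t))
        have f7 := mul_nonneg hH0 (sq_nonneg (D 1 t))
        have f8 := mul_nonneg hH0 (sq_nonneg (D 2 t))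
        have f9 := sq_nonneg (D 0 t)
        have f10 := sq_nonneg (D 3 t)
        linarith
    have hend : ∀ i, D i τ₀ = 0 := by
      intro i
      have hm : τ₀ ∈ Icc 0 τ₀ := right_mem_Icc.2 h.le
      simp only [hD, ext_apply h _ hm, coord_apply, hUV, sub_self]
    have hle := hmono (left_mem_Icc.2 hε.2.le) (right_mem_Icc.2 hε.2.le) hε.2.le
    simp only [hN, hend] at hle
    have hle2 : D 0 ε ^ 2 + D 1 ε ^ 2 + D 2 ε ^ 2 + D 3 ε ^ 2 ≤ 0 := by
      by_contra hcon
      push Not at hcon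
      have := mul_pos hcon (Real.exp_pos (K * ε))
      linarith
    have g0 := sq_nonneg (D 0 ε)
    have g1 := sq_nonneg (D 1 ε)
    have g2 := sq_nonneg (D 2 ε)
    have g3 := sq_nonneg (D 3 ε)
    intro i
    fin_cases i <;> refine pow_eq_zero_iff (two_ne_zero) |>.1 (le_antisymm ?_ (sq_nonneg _)) <;>
      simp only [Fin.zero_eta, Fin.mk_one, Fin.reduceFinMk] <;> linarith
  have hall : ∀ i, EqOn (D i) (fun _ => 0) (Icc 0 τ₀) := fun i =>
    EqOn.of_subset_closure (fun t ht => hzero t ht i) (hDc i).continuousOn continuousOn_const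
      Ioo_subset_Icc_self (by rw [closure_Ioo h.ne])
  ext t i
  have := hall i t.2
  simp only [hD, ext_apply h _ t.2, coord_apply] at this
  exact sub_eq_zero.1 this

end Uniqueness

/-! ### Reparametrization by endpoint coefficients. -/

section Endpoint

variable {τ₀ : ℝ} (h : 0 < τ₀)

/-- The coefficient of `V_{i+1}(τ₀)` in the endpoint value of a curve. -/
def endCoef (i : Fin 4) : C(Icc (0 : ℝ) τ₀, E4) →L[ℝ] ℝ :=
  (frameCoef τ₀ i).comp (ContinuousMap.evalCLM ℝ ⟨τ₀, right_mem_Icc.2 h.le⟩)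

theorem endCoef_apply (i : Fin 4) (U : C(Icc (0 : ℝ) τ₀, E4)) :
    endCoef h i U = frameCoef τ₀ i (U ⟨τ₀, right_mem_Icc.2 h.le⟩) := rfl

/-- The coefficients of `V₁(τ₀)` and `V₂(τ₀)` in the endpoint value of a curve. -/
def freeCoef : C(Icc (0 : ℝ) τ₀, E4) →L[ℝ] E2 :=
  ((EuclideanSpace.equiv (Fin 2) ℝ).symm : (Fin 2 → ℝ) →L[ℝ] E2).comp
    (ContinuousLinearMap.pi ![endCoef h 0, endCoef h 1])

theorem freeCoef_apply (U : C(Icc (0 : ℝ) τ₀, E4)) :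
    freeCoef h U = !₂[endCoef h 0 U, endCoef h 1 U] := by
  ext i
  fin_cases i <;> rfl

theorem endpoint_eq (U : C(Icc (0 : ℝ) τ₀, E4)) : U ⟨τ₀, right_mem_Icc.2 h.le⟩ =
    freeCoef h U 0 • V1 τ₀ + freeCoef h U 1 • V2 τ₀ + endCoef h 2 U • V3 τ₀
      + endCoef h 3 U • V4 τ₀ := by
  conv_lhs => rw [← sum_frameCoef_smul h (U ⟨τ₀, right_mem_Icc.2 h.le⟩), frameComb]
  simp [freeCoef_apply, endCoef_apply]

theorem endCoef_of_endpoint_eq {U : C(Icc (0 : ℝ) τ₀, E4)} {c : Fin 4 → ℝ}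
    (hU : U ⟨τ₀, right_mem_Icc.2 h.le⟩ =
      c 0 • V1 τ₀ + c 1 • V2 τ₀ + c 2 • V3 τ₀ + c 3 • V4 τ₀) (i : Fin 4) :
    endCoef h i U = c i := by
  rw [endCoef_apply, hU, ← frameComb, frameCoef_frameComb h]

theorem endCoef_regularSol (x : E2) (i : Fin 4) :
    endCoef h i (regularSol h x) = ![x 0, x 1, 0, 0] i := by
  refine endCoef_of_endpoint_eq h (c := ![x 0, x 1, 0, 0]) ?_ i
  rw [regularSol_eq]
  simp

theorem freeCoef_regularSol (x : E2) : freeCoef h (regularSol h x) = x := by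
  rw [freeCoef_apply, endCoef_regularSol, endCoef_regularSol]
  ext i
  fin_cases i <;> simp

/-- The particular solution whose endpoint has no component along `V₁(τ₀)`, `V₂(τ₀)`. -/
def projectedSol : C(Icc (0 : ℝ) τ₀, ℝ) →L[ℝ] C(Icc (0 : ℝ) τ₀, E4) :=
  particularSol h - (regularSol h).comp ((freeCoef h).comp (particularSol h))

theorem projectedSol_apply (f : C(Icc (0 : ℝ) τ₀, ℝ)) :
    projectedSol h f = particularSol h f - regularSol h (freeCoef h (particularSol h f)) := rfl

theorem freeCoef_projectedSol (f : C(Icc (0 : ℝ) τ₀, ℝ)) : freeCoef h (projectedSol h f) = 0 := by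
  rw [projectedSol_apply, map_sub, freeCoef_regularSol, sub_self]

/-- The V₄ coefficient is the coefficient of Q in u₂, and in the Green formula for u₂ that
coefficient is minus the moment of f against P. This is the source of the integral 𝓘. -/
theorem endCoef_three_projectedSol (f : C(Icc (0 : ℝ) τ₀, ℝ)) :
    endCoef h 3 (projectedSol h f) = -momP (ext h f) τ₀ := by
  rw [projectedSol_apply, map_sub, endCoef_regularSol, endCoef_apply, frameCoef_three, coefQ_apply,
    particularSol_apply]
  have hW := wronskian h
  simp only [greenOp_apply, greenOp'_apply, greenFun, greenFun']
  simp
  linear_combination momP (ext h f) τ₀ * hW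

/-- The homogeneous parameter x is traded for the V₁, V₂ coefficients at τ₀, from which it differs
by those of the particular solution. -/
theorem isCoreSolution_iff_eq (ν η lam : ℝ) (U : C(Icc (0 : ℝ) τ₀, E4)) :
    IsCoreSolution ν η lam h U ↔
      U = regularSol h (freeCoef h U) + projectedSol h (cubic ν η lam (coord τ₀ 0 U)) := by
  rw [isCoreSolution_iff_exists]
  set f := cubic ν η lam (coord τ₀ 0 U) with hf
  constructor
  · rintro ⟨x, hx⟩
    have h1 : freeCoef h U = x + freeCoef h (particularSol h f) := by
      rw [hx, map_add, freeCoef_regularSol]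
    rw [h1, projectedSol_apply, map_add]
    rw [hx] at *
    abel
  · intro hU
    refine ⟨freeCoef h U - freeCoef h (particularSol h f), ?_⟩
    rw [map_sub]
    refine hU.trans ?_
    rw [projectedSol_apply]
    abel

end Endpoint

/-! ### Quadratic expansion of the forcing and remainder estimates. -/

section Expansion

variable {X : Type*} [NormedCommRing X] [NormedAlgebra ℝ X]

/-- Uses u² - (u - w)² = w(2u - w) with u - w = xP + yA; w will be the second-order correction, so
all remaining terms are of higher order or carry λ. -/
theorem map_cubic_expand (M : X →L[ℝ] ℝ) (ν η lam x y : ℝ) (P A w u : X)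
    (hu : u = x • P + y • A + w) :
    M (cubic ν η lam u) = ν * (x ^ 2 * M (P ^ 2) + 2 * (x * y) * M (P * A) + y ^ 2 * M (A ^ 2))
      + M (lam • u + ν • (w * (u + u - w)) - η • u ^ 3) := by
  have : cubic ν η lam u = ν • (x ^ 2 • P ^ 2 + (2 * (x * y)) • (P * A) + y ^ 2 • A ^ 2)
      + (lam • u + ν • (w * (u + u - w)) - η • u ^ 3) := by
    rw [cubic, hu]
    simp only [Algebra.smul_def, map_mul, map_pow, map_ofNat]
    ring
  rw [this]
  simp only [map_add, map_sub, map_smul, smul_eq_mul]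

/-- Size of the forcing and of the remainder in the quadratic expansion. -/
theorem exists_cubic_bounds (ν η c c' : ℝ) (hc : 0 ≤ c) (hc' : 0 ≤ c') : ∃ C : ℝ, 0 ≤ C ∧
    ∀ (lam n : ℝ) (u w : X), |lam| ≤ 1 → 0 ≤ n → n ≤ 1 → ‖u‖ ≤ c * n →
      ‖w‖ ≤ c' * (|lam| * n + n ^ 2) →
      ‖cubic ν η lam u‖ ≤ C * (|lam| * n + n ^ 2) ∧
      ‖lam • u + ν • (w * (u + u - w)) - η • u ^ 3‖ ≤ C * (|lam| * n + n ^ 3) := by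
  refine ⟨c + |ν| * c ^ 2 + |η| * c ^ 3 + |ν| * (c' * (2 * c + 2 * c')), by positivity, ?_⟩
  intro lam n u w hlam hn0 hn1 hu hw
  have hl0 := abs_nonneg lam
  have hu2 : ‖u ^ 2‖ ≤ c ^ 2 * n ^ 2 := by
    refine (norm_pow_le' u (by norm_num)).trans ?_
    rw [← mul_pow]; gcongr
  have hu3 : ‖u ^ 3‖ ≤ c ^ 3 * n ^ 3 := by
    refine (norm_pow_le' u (by norm_num)).trans ?_
    rw [← mul_pow]; gcongr
  have hn32 : n ^ 3 ≤ n ^ 2 := pow_le_pow_of_le_one hn0 hn1 (by norm_num)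
  have hn21 : n ^ 2 ≤ n := by nlinarith
  have hln0 : 0 ≤ |lam| * n := by positivity
  have hln1 : |lam| * n ≤ n := mul_le_of_le_one_left hn0 hlam
  have hw2 : ‖w‖ ≤ 2 * c' * n := hw.trans (by nlinarith)
  constructor
  · calc ‖cubic ν η lam u‖ ≤ ‖lam • u‖ + ‖ν • u ^ 2‖ + ‖η • u ^ 3‖ :=
          (norm_sub_le _ _).trans (by gcongr; exact norm_add_le _ _)
      _ ≤ |lam| * (c * n) + |ν| * (c ^ 2 * n ^ 2) + |η| * (c ^ 3 * n ^ 3) := by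
          rw [norm_smul, norm_smul, norm_smul, Real.norm_eq_abs, Real.norm_eq_abs,
            Real.norm_eq_abs]
          gcongr
      _ ≤ |lam| * (c * n) + |ν| * (c ^ 2 * n ^ 2) + |η| * (c ^ 3 * n ^ 2) := by gcongr
      _ = c * (|lam| * n) + (|ν| * c ^ 2 + |η| * c ^ 3) * n ^ 2 := by ring
      _ ≤ (c + |ν| * c ^ 2 + |η| * c ^ 3 + |ν| * (c' * (2 * c + 2 * c'))) * (|lam| * n)
          + (c + |ν| * c ^ 2 + |η| * c ^ 3 + |ν| * (c' * (2 * c + 2 * c'))) * n ^ 2 := by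
          have e1 : 0 ≤ |ν| * c ^ 2 + |η| * c ^ 3 + |ν| * (c' * (2 * c + 2 * c')) := by positivity
          have e2 : 0 ≤ c + |ν| * (c' * (2 * c + 2 * c')) := by positivity
          exact add_le_add (mul_le_mul_of_nonneg_right (by linarith) hln0)
            (mul_le_mul_of_nonneg_right (by linarith) (by positivity))
      _ = _ := by ring
  · have hprod : ‖w * (u + u - w)‖ ≤ c' * (2 * c + 2 * c') * (|lam| * n + n ^ 3) := by
      have e1 : ‖u + u - w‖ ≤ (2 * c + 2 * c') * n := by
        have := norm_sub_le (u + u) w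
        have := norm_add_le u u
        linarith
      calc _ ≤ ‖w‖ * ‖u + u - w‖ := norm_mul_le _ _
        _ ≤ (c' * (|lam| * n + n ^ 2)) * ((2 * c + 2 * c') * n) := by gcongr
        _ = c' * (2 * c + 2 * c') * ((|lam| * n) * n + n ^ 3) := by ring
        _ ≤ _ := by
          have := mul_le_of_le_one_right hln0 hn1
          exact mul_le_mul_of_nonneg_left (by linarith) (by positivity)
    calc _ ≤ ‖lam • u‖ + ‖ν • (w * (u + u - w))‖ + ‖η • u ^ 3‖ :=
          (norm_sub_le _ _).trans (by gcongr; exact norm_add_le _ _)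
      _ ≤ |lam| * (c * n) + |ν| * (c' * (2 * c + 2 * c') * (|lam| * n + n ^ 3))
          + |η| * (c ^ 3 * n ^ 3) := by
          rw [norm_smul, norm_smul, norm_smul, Real.norm_eq_abs, Real.norm_eq_abs,
            Real.norm_eq_abs]
          gcongr
      _ = (c + |ν| * (c' * (2 * c + 2 * c'))) * (|lam| * n)
          + (|η| * c ^ 3 + |ν| * (c' * (2 * c + 2 * c'))) * n ^ 3 := by ring
      _ ≤ (c + |ν| * c ^ 2 + |η| * c ^ 3 + |ν| * (c' * (2 * c + 2 * c'))) * (|lam| * n)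
          + (c + |ν| * c ^ 2 + |η| * c ^ 3 + |ν| * (c' * (2 * c + 2 * c'))) * n ^ 3 := by
          have e1 : 0 ≤ |ν| * c ^ 2 := by positivity
          have e2 : 0 ≤ |η| * c ^ 3 := by positivity
          exact add_le_add (mul_le_mul_of_nonneg_right (by linarith) hln0)
            (mul_le_mul_of_nonneg_right (by linarith) (by positivity))
      _ = _ := by ring

end Expansion

/-- From (s + t)³ ≤ 4(s³ + t³) and |d₂|³ ≤ |d₂|² in the unit ball; it brings the cubic remainder to
the form in the theorem. -/
theorem norm_E2_cube_le (d : E2) (hd : ‖d‖ ≤ 1) : ‖d‖ ^ 3 ≤ 4 * (|d 0| ^ 3 + |d 1| ^ 2) := by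
  have h0 : |d 1| ≤ 1 := (by simpa using PiLp.norm_apply_le d 1 : |d 1| ≤ ‖d‖).trans hd
  have h1 : ‖d‖ ≤ |d 0| + |d 1| := by
    rw [EuclideanSpace.norm_eq, Fin.sum_univ_two]
    refine Real.sqrt_le_iff.2 ⟨by positivity, ?_⟩
    simp only [Real.norm_eq_abs]
    nlinarith [mul_nonneg (abs_nonneg (d 0)) (abs_nonneg (d 1))]
  have h2 : ‖d‖ ^ 3 ≤ (|d 0| + |d 1|) ^ 3 := by gcongr
  have h3 : |d 1| ^ 3 ≤ |d 1| ^ 2 := pow_le_pow_of_le_one (abs_nonneg _) h0 (by norm_num)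
  have h4 : 0 ≤ (|d 0| + |d 1|) * (|d 0| - |d 1|) ^ 2 := by positivity
  nlinarith

/-- The passage from the quadratic expansion to the two estimates for `a`. -/
theorem quadratic_estimates {ν a m m₁ m₂ I C₁ θ x y L N : ℝ} (hθ : 0 < θ) (hC : 0 ≤ C₁)
    (hL : 0 ≤ L) (hN : N ≤ 4 * (|x| ^ 3 + |y| ^ 2))
    (ha : |a + ν * (x ^ 2 * m + 2 * (x * y) * m₁ + y ^ 2 * m₂)| ≤ C₁ * (L + N)) {C : ℝ}
    (hCge : 4 * C₁ + 2 * |ν * m₁| + |ν * m₂| + |ν| * (m₁ ^ 2 / θ) ≤ C) :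
    |a + m * ν * x ^ 2| ≤ C * (L + |x| * |y| + |y| ^ 2 + |x| ^ 3) ∧
    |a + I * ν * x ^ 2| ≤ (|m - I| + θ) * |ν| * x ^ 2 + C * (L + |y| ^ 2 + |x| ^ 3) := by
  have hx := abs_nonneg x
  have hy := abs_nonneg y
  have hm1 : |2 * (x * y) * m₁ * ν| = 2 * |ν * m₁| * (|x| * |y|) := by
    rw [abs_mul, abs_mul, abs_mul, abs_mul, abs_mul, abs_two]; ring
  have hm2 : |y ^ 2 * m₂ * ν| = |ν * m₂| * |y| ^ 2 := by
    rw [abs_mul, abs_mul, abs_mul, abs_pow]; ring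
  have hx3 : 0 ≤ |x| ^ 3 := by positivity
  have hy2 : 0 ≤ |y| ^ 2 := by positivity
  have hxy : 0 ≤ |x| * |y| := by positivity
  have hq : 0 ≤ |ν| * (m₁ ^ 2 / θ) := by positivity
  have a1 := abs_nonneg (ν * m₁)
  have a2 := abs_nonneg (ν * m₂)
  have hrem : C₁ * (L + N) ≤ 4 * C₁ * (L + |y| ^ 2 + |x| ^ 3) := by nlinarith [mul_nonneg hC hL]
  have main : |a + m * ν * x ^ 2| ≤ 4 * C₁ * (L + |y| ^ 2 + |x| ^ 3)
      + 2 * |ν * m₁| * (|x| * |y|) + |ν * m₂| * |y| ^ 2 := by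
    have e : a + m * ν * x ^ 2 = (a + ν * (x ^ 2 * m + 2 * (x * y) * m₁ + y ^ 2 * m₂))
        - 2 * (x * y) * m₁ * ν - y ^ 2 * m₂ * ν := by ring
    rw [e]
    have e1 := abs_sub ((a + ν * (x ^ 2 * m + 2 * (x * y) * m₁ + y ^ 2 * m₂))
        - 2 * (x * y) * m₁ * ν) (y ^ 2 * m₂ * ν)
    have e2 := abs_sub (a + ν * (x ^ 2 * m + 2 * (x * y) * m₁ + y ^ 2 * m₂))
        (2 * (x * y) * m₁ * ν)
    linarith
  have hT : 0 ≤ L + |y| ^ 2 + |x| ^ 3 := by positivity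
  constructor
  · have e1 : 4 * C₁ * (L + |y| ^ 2 + |x| ^ 3) + 2 * |ν * m₁| * (|x| * |y|) + |ν * m₂| * |y| ^ 2 ≤
        (4 * C₁ + 2 * |ν * m₁| + |ν * m₂| + |ν| * (m₁ ^ 2 / θ)) *
          (L + |x| * |y| + |y| ^ 2 + |x| ^ 3) := by
      have p1 : |ν * m₂| * |y| ^ 2 ≤ |ν * m₂| * (L + |x| * |y| + |y| ^ 2 + |x| ^ 3) := by
        gcongr; linarith
      have p2 : 2 * |ν * m₁| * (|x| * |y|) ≤ 2 * |ν * m₁| * (L + |x| * |y| + |y| ^ 2 + |x| ^ 3) := by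
        gcongr; linarith
      have p3 : 4 * C₁ * (L + |y| ^ 2 + |x| ^ 3) ≤ 4 * C₁ * (L + |x| * |y| + |y| ^ 2 + |x| ^ 3) := by
        gcongr; linarith
      have p4 : 0 ≤ |ν| * (m₁ ^ 2 / θ) * (L + |x| * |y| + |y| ^ 2 + |x| ^ 3) := by positivity
      linarith
    refine main.trans (e1.trans ?_)
    gcongr
  -- Young's inequality with weight θ: the small share goes to x², the large one to y².
  · have amgm : 2 * |ν * m₁| * (|x| * |y|) ≤ θ * |ν| * x ^ 2 + |ν| * (m₁ ^ 2 / θ) * |y| ^ 2 := by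
      have e1 : 2 * |m₁| * (|x| * |y|) ≤ θ * x ^ 2 + m₁ ^ 2 / θ * |y| ^ 2 := by
        have e2 : 0 ≤ (θ * |x| - |m₁| * |y|) ^ 2 / θ := by positivity
        have e3 : (θ * |x| - |m₁| * |y|) ^ 2 / θ =
            θ * |x| ^ 2 + |m₁| ^ 2 / θ * |y| ^ 2 - 2 * |m₁| * (|x| * |y|) := by
          field_simp; ring
        rw [e3, sq_abs x, sq_abs m₁] at e2
        linarith
      calc _ = |ν| * (2 * |m₁| * (|x| * |y|)) := by rw [abs_mul]; ring
        _ ≤ |ν| * (θ * x ^ 2 + m₁ ^ 2 / θ * |y| ^ 2) := by gcongr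
        _ = _ := by ring
    have e4 : a + I * ν * x ^ 2 = (a + m * ν * x ^ 2) - (m - I) * ν * x ^ 2 := by ring
    have e5 := abs_sub (a + m * ν * x ^ 2) ((m - I) * ν * x ^ 2)
    rw [← e4] at e5
    have e6 : |(m - I) * ν * x ^ 2| = |m - I| * |ν| * x ^ 2 := by
      rw [abs_mul, abs_mul, abs_pow, sq_abs]
    have e7 : (4 * C₁ + 2 * |ν * m₁| + |ν * m₂| + |ν| * (m₁ ^ 2 / θ)) * (L + |y| ^ 2 + |x| ^ 3) ≤
        C * (L + |y| ^ 2 + |x| ^ 3) := by gcongr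
    have p1 : |ν * m₂| * |y| ^ 2 ≤ |ν * m₂| * (L + |y| ^ 2 + |x| ^ 3) := by
      gcongr; linarith
    have p2 : |ν| * (m₁ ^ 2 / θ) * |y| ^ 2 ≤ |ν| * (m₁ ^ 2 / θ) * (L + |y| ^ 2 + |x| ^ 3) := by
      gcongr; linarith
    have p3 : 0 ≤ 2 * |ν * m₁| * (L + |y| ^ 2 + |x| ^ 3) := by positivity
    linarith

/-! ### Coefficient estimates and the submanifold criterion. -/

section Main

variable {τ₀ : ℝ} (h : 0 < τ₀)

theorem coord_regularSol (d : E2) : coord τ₀ 0 (regularSol h d) =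
    d 0 • pcMap τ₀ + d 1 • greenOp h (pcMap τ₀) := by
  ext t
  rw [coord_apply, regularSol_apply]
  simp [pcMap_apply]

theorem endCoef_three_projectedSol_sq :
    -endCoef h 3 (projectedSol h (pcMap τ₀ ^ 2)) = ∫ s in (0 : ℝ)..τ₀, pc s ^ 3 * Real.sinh s := by
  rw [endCoef_three_projectedSol, neg_neg]
  refine intervalIntegral.integral_congr fun s hs => ?_
  rw [uIcc_of_le h.le] at hs
  simp only [ext_apply h _ hs, ContinuousMap.pow_apply, pcMap_apply]
  ring

/-- The coefficient estimates for a small solution with free endpoint data `d`. -/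
theorem exists_coef_estimates (ν η c θ : ℝ) (hc : 0 ≤ c) (hθ : 0 < θ) : ∃ C : ℝ,
    ∀ (d : E2) (lam : ℝ) (U : C(Icc (0 : ℝ) τ₀, E4)), ‖d‖ ≤ 1 → |lam| ≤ 1 →
      ‖U‖ ≤ c * ‖d‖ →
      U = regularSol h d + projectedSol h (cubic ν η lam (coord τ₀ 0 U)) →
      |endCoef h 2 U| ≤ C * (|lam| * ‖d‖ + ‖d‖ ^ 2) ∧
      |endCoef h 3 U + (∫ s in (0 : ℝ)..τ₀, pc s ^ 3 * Real.sinh s) * ν * d 0 ^ 2| ≤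
        C * (|lam| * ‖d‖ + |d 0| * |d 1| + |d 1| ^ 2 + |d 0| ^ 3) ∧
      |endCoef h 3 U + calI * ν * d 0 ^ 2| ≤
        (|(∫ s in (0 : ℝ)..τ₀, pc s ^ 3 * Real.sinh s) - calI| + θ) * |ν| * d 0 ^ 2
          + C * (|lam| * ‖d‖ + |d 1| ^ 2 + |d 0| ^ 3) := by
  set p := coord τ₀ 0 with hp
  set K := projectedSol h with hK
  set M : C(Icc (0 : ℝ) τ₀, ℝ) →L[ℝ] ℝ := -((endCoef h 3).comp K) with hM
  set A := greenOp h (pcMap τ₀) with hA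
  -- Two passes: with w = 0 to bound the forcing, then with the correction w that this forcing
  -- produces.
  obtain ⟨Cg, hCg0, hCg⟩ := exists_cubic_bounds (X := C(Icc (0 : ℝ) τ₀, ℝ)) ν η (‖p‖ * c) 0
    (by positivity) le_rfl
  obtain ⟨Ce, hCe0, hCe⟩ := exists_cubic_bounds (X := C(Icc (0 : ℝ) τ₀, ℝ)) ν η (‖p‖ * c)
    (‖p.comp K‖ * Cg) (by positivity) (by positivity)
  set Cb := ‖(endCoef h 2).comp K‖ * Cg with hCb
  set m₁ := M (pcMap τ₀ * A) with hm1
  set m₂ := M (A ^ 2) with hm2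
  set Ca := 4 * (‖M‖ * Ce) + 2 * |ν * m₁| + |ν * m₂| + |ν| * (m₁ ^ 2 / θ) with hCa
  have hCb0 : 0 ≤ Cb := by positivity
  have hCa0 : 0 ≤ Ca := by positivity
  refine ⟨Cb + Ca, fun d lam U hd hlam hU hUeq => ?_⟩
  have hu : ‖p U‖ ≤ ‖p‖ * c * ‖d‖ := by
    rw [mul_assoc]; exact p.le_of_opNorm_le_of_le le_rfl hU
  have hg := (hCg lam ‖d‖ (p U) 0 hlam (norm_nonneg _) hd hu (by simp)).1
  set g := cubic ν η lam (p U) with hgdef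
  set w := p (K g) with hw
  have hwle : ‖w‖ ≤ ‖p.comp K‖ * Cg * (|lam| * ‖d‖ + ‖d‖ ^ 2) := by
    rw [mul_assoc]; exact (p.comp K).le_of_opNorm_le_of_le le_rfl hg
  have hpU : p U = d 0 • pcMap τ₀ + d 1 • A + w := by
    conv_lhs => rw [hUeq]
    rw [map_add, hp, coord_regularSol]
  have herr := (hCe lam ‖d‖ (p U) w hlam (norm_nonneg _) hd hu hwle).2
  have hend2 : endCoef h 2 U = (endCoef h 2).comp K g := by
    conv_lhs => rw [hUeq]
    rw [map_add, endCoef_regularSol]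
    simp
  have hend3 : endCoef h 3 U = -M g := by
    conv_lhs => rw [hUeq]
    rw [map_add, endCoef_regularSol]
    simp [hM]
  have hMsq : M (pcMap τ₀ ^ 2) = ∫ s in (0 : ℝ)..τ₀, pc s ^ 3 * Real.sinh s :=
    endCoef_three_projectedSol_sq h
  have hexp := map_cubic_expand M ν η lam (d 0) (d 1) (pcMap τ₀) A w (p U) hpU
  rw [← hgdef, hMsq, ← hm1, ← hm2] at hexp
  have ha : |endCoef h 3 U + ν * (d 0 ^ 2 * (∫ s in (0 : ℝ)..τ₀, pc s ^ 3 * Real.sinh s)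
      + 2 * (d 0 * d 1) * m₁ + d 1 ^ 2 * m₂)| ≤ ‖M‖ * Ce * (|lam| * ‖d‖ + ‖d‖ ^ 3) := by
    rw [hend3, hexp, neg_add_eq_sub, sub_add_cancel_left, abs_neg, mul_assoc]
    exact M.le_of_opNorm_le_of_le le_rfl herr
  obtain ⟨q1, q2⟩ := quadratic_estimates (I := calI) hθ (by positivity) (by positivity)
    (norm_E2_cube_le d hd) ha (C := Cb + Ca) (by linarith)
  refine ⟨?_, q1, q2⟩
  have hb : |endCoef h 2 U| ≤ Cb * (|lam| * ‖d‖ + ‖d‖ ^ 2) := by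
    rw [hend2, hCb, mul_assoc]
    exact ((endCoef h 2).comp K).le_of_opNorm_le_of_le le_rfl hg
  refine hb.trans ?_
  gcongr
  linarith

/-- A set that is the image of an open set under a smooth map with a continuous linear left inverse
is a smooth submanifold. -/
theorem isSmoothSubmanifold_of_leftInverse {X : Type*} [NormedAddCommGroup X] [NormedSpace ℝ X]
    {n : ℕ} {S : Set X} (φ : EuclideanSpace ℝ (Fin n) → X)
    (κ : X →L[ℝ] EuclideanSpace ℝ (Fin n)) {D : Set (EuclideanSpace ℝ (Fin n))} (hD : IsOpen D)
    (hφ : ContDiffOn ℝ ∞ φ D) (hS : φ '' D = S) (hκ : ∀ y ∈ D, κ (φ y) = y) :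
    IsSmoothSubmanifold n S := by
  intro p _
  refine ⟨univ, D, φ, κ, isOpen_univ, mem_univ _, hD, hφ, fun y hy => ?_, by rw [hS, inter_univ],
    κ.continuous.continuousOn, hκ⟩
  have hdiff : DifferentiableAt ℝ φ y :=
    (hφ.contDiffAt (hD.mem_nhds hy)).differentiableAt (by simp)
  have h1 : HasFDerivAt (fun z => κ (φ z)) (κ.comp (fderiv ℝ φ y)) y :=
    κ.hasFDerivAt.comp y hdiff.hasFDerivAt
  have h2 : HasFDerivAt (fun z => κ (φ z)) (ContinuousLinearMap.id ℝ _) y := by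
    refine (hasFDerivAt_id y).congr_of_eventuallyEq ?_
    filter_upwards [hD.mem_nhds hy] with z hz using hκ z hz
  have h3 := h1.unique h2
  refine Function.LeftInverse.injective (g := κ) fun v => ?_
  exact congrArg (fun L : EuclideanSpace ℝ (Fin n) →L[ℝ] EuclideanSpace ℝ (Fin n) => L v) h3

end Main

end HyperbolicSH

end

/-! ### Choice of radii and assembly. -/

theorem mainTheorem10 (ν η : ℝ) :
    -- the integral defining `𝓘` converges
    IntegrableOn (fun s : ℝ => HyperbolicSH.pc s ^ 3 * Real.sinh s) (Ioi 0) ∧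
    -- `ρ` and `ε` are the `o(1)` terms, as `τ₀ → ∞`
    ∃ ρ ε : ℝ → ℝ, Tendsto ρ atTop (𝓝 0) ∧ Tendsto ε atTop (𝓝 0) ∧
    ∀ (τ₀ : ℝ) (hτ₀ : 0 < τ₀),
      -- the projection `coreProj τ₀` is well defined
      LinearIndependent ℝ (HyperbolicSH.frame τ₀) ∧
      ∃ (δ₀ δ₁ C : ℝ) (b a : HyperbolicSH.E2 × ℝ → ℝ), 0 < δ₀ ∧ 0 < δ₁ ∧
        (∀ lam : ℝ, |lam| < δ₀ →
          HyperbolicSH.IsSmoothSubmanifold 2 (HyperbolicSH.coreManifold ν η lam hτ₀ δ₀)) ∧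
        -- `b` and `a` are the coefficients of `V₃(τ₀)` and `V₄(τ₀)`
        ContDiffOn ℝ ∞ b (Metric.ball 0 δ₁ ×ˢ Ioo (-δ₀) δ₀) ∧
        ContDiffOn ℝ ∞ a (Metric.ball 0 δ₁ ×ˢ Ioo (-δ₀) δ₀) ∧
        (∀ (d : HyperbolicSH.E2) (lam : ℝ), ‖d‖ < δ₁ → |lam| < δ₀ →
          |b (d, lam)| ≤ C * (|lam| * ‖d‖ + ‖d‖ ^ 2) ∧
          |a (d, lam) + (HyperbolicSH.calI + ρ τ₀) * ν * d 0 ^ 2| ≤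
            C * (|lam| * ‖d‖ + |d 0| * |d 1| + |d 1| ^ 2 + |d 0| ^ 3) ∧
          |a (d, lam) + HyperbolicSH.calI * ν * d 0 ^ 2| ≤
            ε τ₀ * |ν| * d 0 ^ 2 + C * (|lam| * ‖d‖ + |d 1| ^ 2 + |d 0| ^ 3)) ∧
        (∀ (d : HyperbolicSH.E2) (lam : ℝ), ‖d‖ < δ₁ → |lam| < δ₀ →
          (∀ U : C(Icc (0 : ℝ) τ₀, HyperbolicSH.E4),
            HyperbolicSH.IsCoreSolution ν η lam hτ₀ U →
            ((U ∈ HyperbolicSH.coreManifold ν η lam hτ₀ δ₀ ∧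
                HyperbolicSH.coreProj τ₀ (U ⟨τ₀, right_mem_Icc.2 hτ₀.le⟩) =
                  d 0 • HyperbolicSH.V1 τ₀ + d 1 • HyperbolicSH.V2 τ₀) ↔
              U ⟨τ₀, right_mem_Icc.2 hτ₀.le⟩ =
                d 0 • HyperbolicSH.V1 τ₀ + d 1 • HyperbolicSH.V2 τ₀
                  + b (d, lam) • HyperbolicSH.V3 τ₀ + a (d, lam) • HyperbolicSH.V4 τ₀)) ∧
          ∃ U ∈ HyperbolicSH.coreManifold ν η lam hτ₀ δ₀,
            U ⟨τ₀, right_mem_Icc.2 hτ₀.le⟩ =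
              d 0 • HyperbolicSH.V1 τ₀ + d 1 • HyperbolicSH.V2 τ₀
                + b (d, lam) • HyperbolicSH.V3 τ₀ + a (d, lam) • HyperbolicSH.V4 τ₀) := by
  open HyperbolicSH in
  refine ⟨integrableOn_pc_cube,
    -- ρ is minus the tail of 𝓘; ε is |ρ| plus the Young weight θ = 1/(1 + |τ₀|).
    fun τ => (∫ s in (0 : ℝ)..τ, pc s ^ 3 * Real.sinh s) - calI,
    fun τ => |(∫ s in (0 : ℝ)..τ, pc s ^ 3 * Real.sinh s) - calI| + 1 / (1 + |τ|),
    tendsto_integral_pc_cube, ?_, ?_⟩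
  · have h1 := tendsto_integral_pc_cube.abs
    have h2 : Tendsto (fun τ : ℝ => 1 / (1 + |τ|)) atTop (𝓝 0) :=
      tendsto_const_nhds.div_atTop (tendsto_atTop_add_const_left _ _ tendsto_abs_atTop_atTop)
    simpa using h1.add h2
  intro τ₀ h
  open HyperbolicSH in
  refine ⟨linearIndependent_frame h, ?_⟩
  open HyperbolicSH in
  obtain ⟨R, r, Φ, hR, hr, hΦs, hΦ⟩ :=
    exists_cubic_fixedPoint ν η (coord τ₀ 0) (projectedSol h) (regularSol h)
  open HyperbolicSH in
  obtain ⟨C, hC⟩ := exists_coef_estimates h ν η (2 * ‖regularSol h‖) (1 / (1 + |τ₀|))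
    (by positivity) (by positivity)
  open HyperbolicSH in
  set T := regularSol h with hT
  open HyperbolicSH in
  set κ := freeCoef h with hκ
  -- The last condition places the endpoint data of every solution in the δ₀-ball inside the domain
  -- of Φ; δ₀ ≤ R gives uniqueness there.
  have hδ : ∃ δ₀ : ℝ, 0 < δ₀ ∧ δ₀ ≤ 1 ∧ δ₀ ≤ R ∧ δ₀ ≤ r ∧ ‖κ‖ * δ₀ < r := by
    refine ⟨min 1 (min R (min r (r / (‖κ‖ + 1)))), by positivity, min_le_left _ _,
      (min_le_right _ _).trans (min_le_left _ _),
      (min_le_right _ _).trans ((min_le_right _ _).trans (min_le_left _ _)), ?_⟩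
    have h1 : min 1 (min R (min r (r / (‖κ‖ + 1)))) ≤ r / (‖κ‖ + 1) :=
      (min_le_right _ _).trans ((min_le_right _ _).trans (min_le_right _ _))
    calc _ ≤ ‖κ‖ * (r / (‖κ‖ + 1)) := by gcongr
      _ = ‖κ‖ / (‖κ‖ + 1) * r := by ring
      _ < r := by
        refine mul_lt_of_lt_one_left hr ?_
        rw [div_lt_one (by positivity)]
        linarith
  obtain ⟨δ₀, hδ₀, hδ1, hδR, hδr, hδκ⟩ := hδ
  -- The last condition forces ‖Φ(d, λ)‖ < δ₀ for |d| < δ₁.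
  have hδ' : ∃ δ₁ : ℝ, 0 < δ₁ ∧ δ₁ ≤ 1 ∧ δ₁ ≤ r ∧ 2 * ‖T‖ * δ₁ < δ₀ := by
    refine ⟨min 1 (min r (δ₀ / (2 * ‖T‖ + 1))), by positivity, min_le_left _ _,
      (min_le_right _ _).trans (min_le_left _ _), ?_⟩
    have h1 : min 1 (min r (δ₀ / (2 * ‖T‖ + 1))) ≤ δ₀ / (2 * ‖T‖ + 1) :=
      (min_le_right _ _).trans (min_le_right _ _)
    calc _ ≤ 2 * ‖T‖ * (δ₀ / (2 * ‖T‖ + 1)) := by gcongr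
      _ = 2 * ‖T‖ / (2 * ‖T‖ + 1) * δ₀ := by ring
      _ < δ₀ := by
        refine mul_lt_of_lt_one_left hδ₀ ?_
        rw [div_lt_one (by positivity)]
        linarith
  obtain ⟨δ₁, hδ₁, hδ₁1, hδ₁r, hδ₁T⟩ := hδ'
  have hfix : ∀ d lam, ‖d‖ < r → |lam| < δ₀ → Φ (d, lam) = T d + HyperbolicSH.projectedSol h
      (HyperbolicSH.cubic ν η lam (HyperbolicSH.coord τ₀ 0 (Φ (d, lam)))) :=
    fun d lam hd hl => (hΦ d lam hd (hl.trans_le hδr)).1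
  have hΦκ : ∀ d lam, ‖d‖ < r → |lam| < δ₀ → κ (Φ (d, lam)) = d := by
    intro d lam hd hl
    rw [hfix d lam hd hl, map_add, HyperbolicSH.freeCoef_regularSol,
      HyperbolicSH.freeCoef_projectedSol, add_zero]
  have hΦsol : ∀ d lam, ‖d‖ < r → |lam| < δ₀ →
      HyperbolicSH.IsCoreSolution ν η lam h (Φ (d, lam)) := by
    intro d lam hd hl
    rw [HyperbolicSH.isCoreSolution_iff_eq, ← hκ, hΦκ d lam hd hl]
    exact hfix d lam hd hl
  have huniq : ∀ lam, |lam| < δ₀ → ∀ U ∈ HyperbolicSH.coreManifold ν η lam h δ₀,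
      ‖κ U‖ < r ∧ U = Φ (κ U, lam) := by
    rintro lam hl U ⟨hU, hUn⟩
    have h1 : ‖κ U‖ < r := (κ.le_of_opNorm_le_of_le le_rfl hUn.le).trans_lt hδκ
    exact ⟨h1, (hΦ _ lam h1 (hl.trans_le hδr)).2.2 U (hUn.trans_le hδR)
      ((HyperbolicSH.isCoreSolution_iff_eq h ν η lam U).1 hU)⟩
  have hsmall : ∀ d lam, ‖d‖ < δ₁ → |lam| < δ₀ → ‖Φ (d, lam)‖ < δ₀ := by
    intro d lam hd hl
    refine ((hΦ d lam (hd.trans_le hδ₁r) (hl.trans_le hδr)).2.1).trans_lt ?_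
    refine lt_of_le_of_lt ?_ hδ₁T
    gcongr
  have hΦend : ∀ d lam, ‖d‖ < r → |lam| < δ₀ → Φ (d, lam) ⟨τ₀, right_mem_Icc.2 h.le⟩ =
      d 0 • HyperbolicSH.V1 τ₀ + d 1 • HyperbolicSH.V2 τ₀
        + HyperbolicSH.endCoef h 2 (Φ (d, lam)) • HyperbolicSH.V3 τ₀
        + HyperbolicSH.endCoef h 3 (Φ (d, lam)) • HyperbolicSH.V4 τ₀ := by
    intro d lam hd hl
    have := HyperbolicSH.endpoint_eq h (Φ (d, lam))
    rwa [← hκ, hΦκ d lam hd hl] at this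
  have hsub : Metric.ball (0 : HyperbolicSH.E2) δ₁ ×ˢ Ioo (-δ₀) δ₀ ⊆
      Metric.ball 0 r ×ˢ Ioo (-r) r :=
    prod_mono (Metric.ball_subset_ball hδ₁r) (Ioo_subset_Ioo (neg_le_neg hδr) hδr)
  refine ⟨δ₀, δ₁, C, fun q => HyperbolicSH.endCoef h 2 (Φ q),
    fun q => HyperbolicSH.endCoef h 3 (Φ q), hδ₀, hδ₁, fun lam hl => ?_,
    (HyperbolicSH.endCoef h 2).contDiff.comp_contDiffOn (hΦs.mono hsub),
    (HyperbolicSH.endCoef h 3).contDiff.comp_contDiffOn (hΦs.mono hsub),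
    fun d lam hd hl => ?_, fun d lam hd hl => ⟨fun U hU => ⟨?_, ?_⟩, ?_⟩⟩
  · have hs : ContDiffOn ℝ ∞ (fun d => Φ (d, lam)) (Metric.ball 0 r) := by
      refine hΦs.comp (contDiff_id.prodMk contDiff_const).contDiffOn fun d hd => ⟨hd, ?_⟩
      exact abs_lt.1 (hl.trans_le hδr)
    -- The chart domain is the open set of d with ‖Φ(d, λ)‖ < δ₀, so its image is exactly the
    -- manifold.
    have hopen := hs.continuousOn.norm.isOpen_inter_preimage Metric.isOpen_ball (isOpen_Iio (a := δ₀))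
    refine HyperbolicSH.isSmoothSubmanifold_of_leftInverse (fun d => Φ (d, lam)) κ hopen
      (hs.mono inter_subset_left) ?_ fun d hd => hΦκ d lam (mem_ball_zero_iff.1 hd.1) hl
    ext U
    constructor
    · rintro ⟨d, ⟨hd, hn⟩, rfl⟩
      exact ⟨hΦsol d lam (mem_ball_zero_iff.1 hd) hl, hn⟩
    · intro hU
      obtain ⟨h1, h2⟩ := huniq lam hl U hU
      exact ⟨κ U, ⟨mem_ball_zero_iff.2 h1, by rw [mem_preimage, ← h2]; exact hU.2⟩, h2.symm⟩
  · have := hC d lam (Φ (d, lam)) (hd.le.trans hδ₁1) (hl.le.trans hδ1)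
      (hΦ d lam (hd.trans_le hδ₁r) (hl.trans_le hδr)).2.1 (hfix d lam (hd.trans_le hδ₁r) hl)
    simpa only [add_sub_cancel] using this
  · rintro ⟨hmem, hproj⟩
    have hκU : κ U = d := by
      rw [HyperbolicSH.endpoint_eq h U] at hproj
      have e1 := HyperbolicSH.coreProj_frameComb h
        ![κ U 0, κ U 1, HyperbolicSH.endCoef h 2 U, HyperbolicSH.endCoef h 3 U]
      rw [HyperbolicSH.frameComb] at e1
      have e2 := e1.symm.trans hproj
      have e3 : ∑ j, (![κ U 0, κ U 1, 0, 0] : Fin 4 → ℝ) j • HyperbolicSH.frame τ₀ j =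
          ∑ j, (![d 0, d 1, 0, 0] : Fin 4 → ℝ) j • HyperbolicSH.frame τ₀ j := by
        rw [HyperbolicSH.frameComb, HyperbolicSH.frameComb]
        simpa using e2
      ext i
      fin_cases i
      · have := congrArg (HyperbolicSH.frameCoef τ₀ 0) e3
        rwa [HyperbolicSH.frameCoef_frameComb h, HyperbolicSH.frameCoef_frameComb h] at this
      · have := congrArg (HyperbolicSH.frameCoef τ₀ 1) e3
        rwa [HyperbolicSH.frameCoef_frameComb h, HyperbolicSH.frameCoef_frameComb h] at this
    have h2 := (huniq lam hl U hmem).2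
    rw [hκU] at h2
    rw [h2]
    exact hΦend d lam (hd.trans_le hδ₁r) hl
  · intro hend
    have hdr := hd.trans_le hδ₁r
    -- U is not yet known to be small, so the uniqueness in the fixed-point theorem does not apply.
    have hUΦ : U = Φ (d, lam) := HyperbolicSH.IsCoreSolution.eq_of_endpoint h hU
      (hΦsol d lam hdr hl) (hend.trans (hΦend d lam hdr hl).symm)
    refine ⟨⟨hU, by rw [hUΦ]; exact hsmall d lam hd hl⟩, ?_⟩
    have e1 := HyperbolicSH.coreProj_frameComb h
      ![d 0, d 1, HyperbolicSH.endCoef h 2 (Φ (d, lam)), HyperbolicSH.endCoef h 3 (Φ (d, lam))]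
    rw [HyperbolicSH.frameComb] at e1
    rw [hend]
    exact e1
  · exact ⟨Φ (d, lam), ⟨hΦsol d lam (hd.trans_le hδ₁r) hl, hsmall d lam hd hl⟩,
      hΦend d lam (hd.trans_le hδ₁r) hl⟩
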